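/- Let $\mathbf{HA}$ be Heyting arithmetic: the intuitionistic first-order theory with equality, in the connectives $\bot,\land,\lor,\to,\forall,\exists$ (where $\neg\varphi$ is $\varphi\to\bot$), in the language with a function symbol for every primitive recursive function, whose axioms are the successor axioms, the defining equations of the primitive recursive functions and the induction scheme for all formulas. Let $\Sigma_0=\Pi_0$ be the set of quantifier-free formulas, let $\Sigma_{k+1}$ be the set of formulas $\exists x_1\cdots\exists x_n\,\varphi$ with $n\ge 1$ and $\varphi\in\Pi_k$, and let $\Pi_{k+1}$ be the set of formulas $\forall x_1\cdots\forall x_n\,\varphi$ with $n\ge 1$ and $\varphi\in\Sigma_k$. For a set $\Gamma$ of formulas (which may contain further free variables as parameters) consider the principles - $\mathbf{LEM}_\Gamma$: $\varphi\lor\neg\varphi$ for $\varphi\in\Gamma$; - $\mathbf{DNE}_\Gamma$: $\neg\neg\varphi\to\varphi$ for $\varphi\in\Gamma$; - $\mathbf{DML}_\Gamma$: $\neg(\varphi\land\psi)\to\neg\varphi\lor\neg\psi$ for $\varphi,\psi\in\Gamma$; - $\mathbf{COLL}_\Gamma$: $\forall w\,\exists y<x\,\forall z<w\,\varphi(y,z)\to\exists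 y<x\,\forall z\,\varphi(y,z)$ for $\varphi(y,z)\in\Gamma$, where $x,y,z,w$ are distinct variables and $w$ is not free in $\varphi$. For a theory $T$ and a principle $P$, $T+P$ is obtained from $T$ by adding the universal closures of all instances of $P$ as axioms. Principles $P$ and $Q$ are equivalent over $\mathbf{HA}$ if $\mathbf{HA}+P$ proves every instance of $Q$ and $\mathbf{HA}+Q$ proves every instance of $P$. Then for every natural number $k\ge 0$ the following are pairwise equivalent over $\mathbf{HA}$: 1. $\mathbf{COLL}_{\Pi_{k+1}}$; 2. $\mathbf{DML}_{\Sigma_{k+1}}+\mathbf{LEM}_{\Sigma_k}$; 3. $\mathbf{DML}_{\Sigma_{k+1}}+\mathbf{DNE}_{\Sigma_k}$. Moreover, for every $\Pi_{k+1}$ formula $\varphi(y)$ and every variable $x$ other than $y$ there is a $\Pi_{k+1}$ formula $\psi(x)$ such that $$\mathbf{HA}+\mathbf{DML}_{\Sigma_{k+1}}+\mathbf{DNE}_{\Sigma_k}\vdash \exists y<x\,\varphi(y)\leftrightarrow\psi(x).$$ -/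

import Mathlib

namespace HeytingArith

/-- Function symbols: one symbol of arity `n` for every description of an `n`-ary primitive
recursive function (constant `0`, successor, projections, composition, primitive recursion on the
first argument). -/
inductive PRSymb : ℕ → Type
  | zero : PRSymb 0
  | succ : PRSymb 1
  | proj {n : ℕ} (i : Fin n) : PRSymb n
  | comp {m n : ℕ} (f : PRSymb m) (g : Fin m → PRSymb n) : PRSymb n
  | prec {n : ℕ} (f : PRSymb n) (g : PRSymb (n + 2)) : PRSymb (n + 1)

/-- The language of first-order arithmetic with a symbol for each primitive recursive function.
Equality is the only predicate; it is part of the logic. -/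
abbrev arithLang : FirstOrder.Language.{0, 0} where
  Functions := PRSymb
  Relations := fun _ => Empty

/-- Terms. Variables are de Bruijn indices. -/
abbrev Tm : Type := arithLang.Term ℕ

/-- The variable with index `i`. -/
abbrev v (i : ℕ) : Tm := FirstOrder.Language.Term.var i

/-- Application of a function symbol. -/
abbrev app {n : ℕ} (f : PRSymb n) (ts : Fin n → Tm) : Tm :=
  FirstOrder.Language.Term.func (L := arithLang) f ts

/-- The constant `0`. -/
def zeroT : Tm := app PRSymb.zero ![]

/-- The successor of a term. -/
def succT (t : Tm) : Tm := app PRSymb.succ ![t]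

/-- Increase every variable of a term by one. -/
def shiftT (t : Tm) : Tm := t.relabel Nat.succ

/-- Predecessor: `pred 0 = 0`, `pred (y + 1) = y`. -/
def predSymb : PRSymb 1 := PRSymb.prec PRSymb.zero (PRSymb.proj 0)

/-- Truncated subtraction with exchanged arguments: `rsub (0, x) = x`,
`rsub (y + 1, x) = pred (rsub (y, x))`, that is, `rsub (y, x) = x ∸ y`. -/
def rsubSymb : PRSymb 2 := PRSymb.prec (PRSymb.proj 0) (PRSymb.comp predSymb ![PRSymb.proj 1])

/-- Formulas of first-order intuitionistic arithmetic. A quantifier binds the index `0`; the index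
`n` outside the quantifier is the index `n + 1` inside. -/
inductive Fml : Type
  | bot : Fml
  | eq (s t : Tm) : Fml
  | and (φ ψ : Fml) : Fml
  | or (φ ψ : Fml) : Fml
  | imp (φ ψ : Fml) : Fml
  | all (φ : Fml) : Fml
  | ex (φ : Fml) : Fml

namespace Fml

/-- `¬ φ` is `φ → ⊥`. -/
def neg (φ : Fml) : Fml := imp φ bot

/-- `φ ↔ ψ`. -/
def iff (φ ψ : Fml) : Fml := and (imp φ ψ) (imp ψ φ)

end Fml

/-- The substitution `σ`, moved under one quantifier. -/
def up (σ : ℕ → Tm) : ℕ → Tm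
  | 0 => v 0
  | n + 1 => shiftT (σ n)

namespace Fml

/-- Capture-avoiding simultaneous substitution. -/
def subst : Fml → (ℕ → Tm) → Fml
  | bot, _ => bot
  | eq s t, σ => eq (s.subst σ) (t.subst σ)
  | and φ ψ, σ => and (φ.subst σ) (ψ.subst σ)
  | or φ ψ, σ => or (φ.subst σ) (ψ.subst σ)
  | imp φ ψ, σ => imp (φ.subst σ) (ψ.subst σ)
  | all φ, σ => all (φ.subst (up σ))
  | ex φ, σ => ex (φ.subst (up σ))

/-- Increase every free variable of a formula by one. -/
def shift (φ : Fml) : Fml := φ.subst fun n => v (n + 1)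

/-- Substitute the term `t` for the variable `0` and decrease the other free variables by one:
the instance `φ(t)` of `∀ x φ(x)`. -/
def inst (φ : Fml) (t : Tm) : Fml :=
  φ.subst fun n => match n with
    | 0 => t
    | m + 1 => v m

/-- `φ(x + 1)`, where `x` is the variable `0` of `φ`; the other variables stay. -/
def instSucc (φ : Fml) : Fml :=
  φ.subst fun n => match n with
    | 0 => succT (v 0)
    | m + 1 => v (m + 1)

/-- A number such that every free variable has a smaller index. -/
def bound : Fml → ℕ
  | bot => 0
  | eq s t => max (s.varFinset.sup Nat.succ) (t.varFinset.sup Nat.succ)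
  | and φ ψ => max φ.bound ψ.bound
  | or φ ψ => max φ.bound ψ.bound
  | imp φ ψ => max φ.bound ψ.bound
  | all φ => φ.bound - 1
  | ex φ => φ.bound - 1

/-- `∀ x₁ ⋯ ∀ xₙ φ`. -/
def alls : ℕ → Fml → Fml
  | 0, φ => φ
  | n + 1, φ => all (alls n φ)

/-- `∃ x₁ ⋯ ∃ xₙ φ`. -/
def exs : ℕ → Fml → Fml
  | 0, φ => φ
  | n + 1, φ => ex (exs n φ)

/-- The universal closure of a formula. -/
def closure (φ : Fml) : Fml := alls φ.bound φ

/-- `s < t`, as the quantifier-free formula `(s + 1) ∸ t = 0`. -/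
def lt (s t : Tm) : Fml := eq (app rsubSymb ![t, succT s]) zeroT

/-- `∃ y < t φ(y)`, where `y` is the variable `0` of `φ` and `t` is a term outside the
quantifier. -/
def exLT (t : Tm) (φ : Fml) : Fml := ex (and (lt (v 0) (shiftT t)) φ)

/-- `∀ y < t φ(y)`, where `y` is the variable `0` of `φ` and `t` is a term outside the
quantifier. -/
def allLT (t : Tm) (φ : Fml) : Fml := all (imp (lt (v 0) (shiftT t)) φ)

/-- Quantifier-free formulas. -/
def QuantifierFree : Fml → Prop
  | bot => True
  | eq _ _ => True
  | and φ ψ => φ.QuantifierFree ∧ ψ.QuantifierFree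
  | or φ ψ => φ.QuantifierFree ∧ ψ.QuantifierFree
  | imp φ ψ => φ.QuantifierFree ∧ ψ.QuantifierFree
  | all _ => False
  | ex _ => False

end Fml

mutual
/-- The class `Σ_k`: `Σ_0` is the class of quantifier-free formulas, and a `Σ_{k+1}` formula is
`∃ x₁ ⋯ ∃ xₙ φ` with `n ≥ 1` and `φ` in `Π_k`. -/
def SigmaF : ℕ → Set Fml
  | 0 => {φ | φ.QuantifierFree}
  | k + 1 => {χ | ∃ n : ℕ, ∃ φ : Fml, 1 ≤ n ∧ φ ∈ PiF k ∧ χ = Fml.exs n φ}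
/-- The class `Π_k`: `Π_0` is the class of quantifier-free formulas, and a `Π_{k+1}` formula is
`∀ x₁ ⋯ ∀ xₙ φ` with `n ≥ 1` and `φ` in `Σ_k`. -/
def PiF : ℕ → Set Fml
  | 0 => {φ | φ.QuantifierFree}
  | k + 1 => {χ | ∃ n : ℕ, ∃ φ : Fml, 1 ≤ n ∧ φ ∈ SigmaF k ∧ χ = Fml.alls n φ}
end

/-- Natural deduction for intuitionistic first-order logic with equality: `Deriv T Γ φ` says that
`φ` is derivable from the axioms in `T`, which are meant to be sentences, and the open
assumptions in `Γ`. The eigenvariable in `allI` and `exE` is the index `0`, fresh because the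
assumptions (and the conclusion of `exE`) are shifted. -/
inductive Deriv (T : Set Fml) : List Fml → Fml → Prop
  | ax {Γ : List Fml} {φ : Fml} : φ ∈ T → Deriv T Γ φ
  | hyp {Γ : List Fml} {φ : Fml} : φ ∈ Γ → Deriv T Γ φ
  | botE {Γ : List Fml} {φ : Fml} : Deriv T Γ Fml.bot → Deriv T Γ φ
  | andI {Γ : List Fml} {φ ψ : Fml} : Deriv T Γ φ → Deriv T Γ ψ → Deriv T Γ (Fml.and φ ψ)
  | andE₁ {Γ : List Fml} {φ ψ : Fml} : Deriv T Γ (Fml.and φ ψ) → Deriv T Γ φ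
  | andE₂ {Γ : List Fml} {φ ψ : Fml} : Deriv T Γ (Fml.and φ ψ) → Deriv T Γ ψ
  | orI₁ {Γ : List Fml} {φ ψ : Fml} : Deriv T Γ φ → Deriv T Γ (Fml.or φ ψ)
  | orI₂ {Γ : List Fml} {φ ψ : Fml} : Deriv T Γ ψ → Deriv T Γ (Fml.or φ ψ)
  | orE {Γ : List Fml} {φ ψ χ : Fml} : Deriv T Γ (Fml.or φ ψ) → Deriv T (φ :: Γ) χ →
      Deriv T (ψ :: Γ) χ → Deriv T Γ χ
  | impI {Γ : List Fml} {φ ψ : Fml} : Deriv T (φ :: Γ) ψ → Deriv T Γ (Fml.imp φ ψ)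
  | impE {Γ : List Fml} {φ ψ : Fml} : Deriv T Γ (Fml.imp φ ψ) → Deriv T Γ φ → Deriv T Γ ψ
  | allI {Γ : List Fml} {φ : Fml} : Deriv T (Γ.map Fml.shift) φ → Deriv T Γ (Fml.all φ)
  | allE {Γ : List Fml} {φ : Fml} (t : Tm) : Deriv T Γ (Fml.all φ) → Deriv T Γ (φ.inst t)
  | exI {Γ : List Fml} {φ : Fml} (t : Tm) : Deriv T Γ (φ.inst t) → Deriv T Γ (Fml.ex φ)
  | exE {Γ : List Fml} {φ ψ : Fml} : Deriv T Γ (Fml.ex φ) →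
      Deriv T (φ :: Γ.map Fml.shift) ψ.shift → Deriv T Γ ψ
  | eqI {Γ : List Fml} (t : Tm) : Deriv T Γ (Fml.eq t t)
  | eqE {Γ : List Fml} (φ : Fml) {s t : Tm} : Deriv T Γ (Fml.eq s t) →
      Deriv T Γ (φ.inst s) → Deriv T Γ (φ.inst t)

/-- `T ⊢ φ`: the universal closure of `φ` is derivable from the axioms `T`. -/
def Provable (T : Set Fml) (φ : Fml) : Prop := Deriv T [] φ.closure

/-- The axioms of Heyting arithmetic, before universal closure. -/
inductive HAAxiomBody : Fml → Prop
  /-- `S x ≠ 0` -/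
  | succ_ne_zero : HAAxiomBody (Fml.neg (Fml.eq (succT (v 0)) zeroT))
  /-- `S x = S y → x = y` -/
  | succ_inj :
      HAAxiomBody (Fml.imp (Fml.eq (succT (v 0)) (succT (v 1))) (Fml.eq (v 0) (v 1)))
  /-- `projᵢ(x₀, …, xₙ₋₁) = xᵢ` -/
  | proj {n : ℕ} (i : Fin n) :
      HAAxiomBody (Fml.eq (app (PRSymb.proj i) fun j => v j) (v i))
  /-- `(f ∘ g)(x₀, …, xₙ₋₁) = f(g₀(x₀, …, xₙ₋₁), …, gₘ₋₁(x₀, …, xₙ₋₁))` -/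
  | comp {m n : ℕ} (f : PRSymb m) (g : Fin m → PRSymb n) :
      HAAxiomBody (Fml.eq (app (PRSymb.comp f g) fun j => v j)
        (app f fun i => app (g i) fun j => v j))
  /-- `h(0, x₁, …, xₙ) = f(x₁, …, xₙ)` for the function `h` defined by recursion from `f`, `g` -/
  | prec_zero {n : ℕ} (f : PRSymb n) (g : PRSymb (n + 2)) :
      HAAxiomBody (Fml.eq
        (app (PRSymb.prec f g) (Fin.cons zeroT fun j : Fin n => v (j + 1)))
        (app f fun j : Fin n => v (j + 1)))
  /-- `h(S y, x₁, …, xₙ) = g(y, h(y, x₁, …, xₙ), x₁, …, xₙ)` -/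
  | prec_succ {n : ℕ} (f : PRSymb n) (g : PRSymb (n + 2)) :
      HAAxiomBody (Fml.eq
        (app (PRSymb.prec f g) (Fin.cons (succT (v 0)) fun j : Fin n => v (j + 1)))
        (app g (Fin.cons (v 0) (Fin.cons
          (app (PRSymb.prec f g) (Fin.cons (v 0) fun j : Fin n => v (j + 1)))
          fun j : Fin n => v (j + 1)))))
  /-- `φ(0) ∧ ∀ x (φ(x) → φ(S x)) → ∀ x φ(x)` -/
  | induction (φ : Fml) :
      HAAxiomBody (Fml.imp (Fml.and (φ.inst zeroT) (Fml.all (Fml.imp φ φ.instSucc)))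
        (Fml.all φ))

/-- Heyting arithmetic, as a set of sentences. -/
def HA : Set Fml := {χ | ∃ φ : Fml, HAAxiomBody φ ∧ χ = φ.closure}

/-- `T + P`: add to `T` the universal closures of all instances of the principle `P`. -/
def addPrinciple (T P : Set Fml) : Set Fml := T ∪ {χ | ∃ φ ∈ P, χ = φ.closure}

/-- `LEM_Γ`: `φ ∨ ¬ φ` for `φ ∈ Γ`. -/
def LEM (C : Set Fml) : Set Fml := {χ | ∃ φ ∈ C, χ = Fml.or φ φ.neg}

/-- `DNE_Γ`: `¬ ¬ φ → φ` for `φ ∈ Γ`. -/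
def DNE (C : Set Fml) : Set Fml := {χ | ∃ φ ∈ C, χ = Fml.imp φ.neg.neg φ}

/-- `DML_Γ`: `¬ (φ ∧ ψ) → ¬ φ ∨ ¬ ψ` for `φ, ψ ∈ Γ`. -/
def DML (C : Set Fml) : Set Fml :=
  {χ | ∃ φ ∈ C, ∃ ψ ∈ C, χ = Fml.imp (Fml.and φ ψ).neg (Fml.or φ.neg ψ.neg)}

/-- The instance `∀ w ∃ y < x ∀ z < w φ(y, z) → ∃ y < x ∀ z φ(y, z)` of contrapositive
collection. In `φ` the variable `z` has index `0`, the variable `y` has index `1`, and the index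
`n + 2` stands for the variable `n` outside; `x` is the variable with index `x` outside. Under the
additional quantifier `∀ w` in the premise the outside variables move up by one, so that `w` is not
free in `φ`. -/
def collInstance (x : ℕ) (φ : Fml) : Fml :=
  Fml.imp
    (Fml.all (Fml.exLT (v (x + 1)) (Fml.allLT (v 1)
      (φ.subst (up (up fun n => v (n + 1)))))))
    (Fml.exLT (v x) (Fml.all φ))

/-- `COLL_Γ`: contrapositive collection for `φ(y, z) ∈ Γ`. -/
def COLL (C : Set Fml) : Set Fml := {χ | ∃ φ ∈ C, ∃ x : ℕ, χ = collInstance x φ}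

/-- The principles `P` and `Q` are equivalent over `T`: `T + P` proves every instance of `Q` and
`T + Q` proves every instance of `P`. -/
def EquivOver (T P Q : Set Fml) : Prop :=
  (∀ φ ∈ Q, Provable (addPrinciple T P) φ) ∧ (∀ φ ∈ P, Provable (addPrinciple T Q) φ)

end HeytingArith

namespace HeytingArith

open FirstOrder Language

-- The argument is semantic. The canonical Kripke model of `HA + P` validates exactly the derivable
-- formulas (`canonicalModel.valid_iff`), so it is enough to compare the principles in an arbitrary
-- Kripke model of `HA`. The metatheory is classical: if `φ` is decidable in the model, then `¬ φ`
-- is forced at a world as soon as `φ` is not, so decidable formulas can be handled classically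
-- world by world.
--
-- All three principles turn out to mean the same in a model: De Morgan's law for `Σ_{k+1}`
-- (`DMLLevel`) together with decidability of `Σ_k` (`DecLevel`). With DNE in place of LEM,
-- decidability is proved level by level: De Morgan's law for `φ` and `¬ φ` gives `¬ φ ∨ ¬ ¬ φ`, and
-- DNE removes the double negation. Decidability of `Σ_k` lets negation exchange `Σ_k` and `Π_k`,
-- closes both under bounded quantifiers (`DecLevel.boundedClosed`), and so collapses each leading
-- block of a level `k + 1` formula to one quantifier.
--
-- For collection (`exists_forces_all_of_forall`), write `∀ z φ(y, z)` as `∀ c θ(c, y)` with `θ`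
-- decidable and antitone in `c`, and suppose that every `c` has some `y < b` with `θ(c, y)`. Use
-- induction on `b`. For `b + 1`, the `Σ_{k+1}` statements `∃ c ¬ ∃ y < b θ(c, y)` and `∃ c ¬ θ(c,
-- b)` cannot both hold, as a number above both witnesses shows. De Morgan's law refutes one of
-- them; then either the induction hypothesis applies or `y = b` works.
--
-- Conversely, collection with the bound `2` chooses between two `Π_{k+1}` statements of which one
-- holds up to each bound (`COLLLevel.all_or_all`). Bounded search for a witness supplies this
-- alternative. Choosing between "no witness" and the formula itself gives decidability, level by
-- level up to `k`; choosing between the absence of witnesses for two `Σ_{k+1}` formulas gives De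
-- Morgan's law.
--
-- For the last claim, `∃ y < x ∀ d ψ` is equivalent to `∀ c ∃ y < x ∀ d < c ψ` by the same
-- collection lemma, and the matrix of the latter is again `Σ_k`.

/-- Put `a` in front of the sequence `ρ`. -/
def scons {α : Type*} (a : α) (ρ : ℕ → α) : ℕ → α
  | 0 => a
  | n + 1 => ρ n

@[simp] theorem scons_zero {α : Type*} (a : α) (ρ : ℕ → α) : scons a ρ 0 = a := rfl

@[simp] theorem scons_succ {α : Type*} (a : α) (ρ : ℕ → α) (n : ℕ) :
    scons a ρ (n + 1) = ρ n := rfl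

theorem comp_scons {α β : Type*} (g : α → β) (a : α) (ρ : ℕ → α) :
    (fun i => g (scons a ρ i)) = scons (g a) fun i => g (ρ i) := by
  funext i; cases i <;> rfl

theorem scons_eta {α : Type*} (ρ : ℕ → α) : scons (ρ 0) (fun i => ρ (i + 1)) = ρ := by
  funext i; cases i <;> rfl

-- Substitution and free variables

theorem Tm.subst_subst (t : Tm) (σ τ : ℕ → Tm) :
    (t.subst σ).subst τ = t.subst fun n => (σ n).subst τ := by
  induction t with
  | var => rfl
  | func f ts ih => simp only [Term.subst]; congr 1; funext i; exact ih i

theorem Tm.subst_var (t : Tm) : t.subst (fun n => v n) = t := by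
  induction t with
  | var => rfl
  | func f ts ih => simp only [Term.subst]; congr 1; funext i; exact ih i

theorem shiftT_eq_subst (t : Tm) : shiftT t = t.subst fun n => v (n + 1) := by
  unfold shiftT
  induction t with
  | var => rfl
  | func f ts ih => simp only [Term.relabel, Term.subst]; congr 1; funext i; exact ih i

theorem up_comp (σ τ : ℕ → Tm) :
    (fun n => (up σ n).subst (up τ)) = up fun n => (σ n).subst τ := by
  funext n
  cases n with
  | zero => rfl
  | succ n => simp only [up, shiftT_eq_subst, Tm.subst_subst, Term.subst]

theorem up_var : up (fun n => v n) = fun n => v n := by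
  funext n; cases n <;> rfl

namespace Fml

theorem subst_subst (φ : Fml) (σ τ : ℕ → Tm) :
    (φ.subst σ).subst τ = φ.subst fun n => (σ n).subst τ := by
  induction φ generalizing σ τ with
  | bot => rfl
  | eq s t => simp [subst, Tm.subst_subst]
  | and φ ψ h₁ h₂ => simp [subst, h₁, h₂]
  | or φ ψ h₁ h₂ => simp [subst, h₁, h₂]
  | imp φ ψ h₁ h₂ => simp [subst, h₁, h₂]
  | all φ ih => simp [subst, ih, up_comp]
  | ex φ ih => simp [subst, ih, up_comp]

theorem subst_var (φ : Fml) : φ.subst (fun n => v n) = φ := by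
  induction φ with
  | bot => rfl
  | eq s t => simp only [subst, Tm.subst_var]
  | and φ ψ h₁ h₂ => simp only [subst, h₁, h₂]
  | or φ ψ h₁ h₂ => simp only [subst, h₁, h₂]
  | imp φ ψ h₁ h₂ => simp only [subst, h₁, h₂]
  | all φ ih => simp only [subst, up_var, ih]
  | ex φ ih => simp only [subst, up_var, ih]

theorem inst_eq (φ : Fml) (t : Tm) : φ.inst t = φ.subst (scons t fun n => v n) := by
  unfold inst; congr 1

theorem instSucc_eq (φ : Fml) :
    φ.instSucc = φ.subst (scons (succT (v 0)) fun n => v (n + 1)) := by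
  unfold instSucc; congr 1

theorem shift_subst_up (φ : Fml) (σ : ℕ → Tm) :
    φ.shift.subst (up σ) = (φ.subst σ).shift := by
  simp only [shift, subst_subst, Term.subst, up, shiftT_eq_subst]

theorem subst_up_inst (φ : Fml) (σ : ℕ → Tm) (t : Tm) :
    (φ.subst (up σ)).inst t = φ.subst (scons t σ) := by
  simp only [inst_eq, subst_subst]
  congr 1; funext n
  cases n with
  | zero => rfl
  | succ n =>
    simp only [up, shiftT_eq_subst, Tm.subst_subst, scons_succ]
    exact Tm.subst_var _

theorem inst_subst (φ : Fml) (σ : ℕ → Tm) (t : Tm) :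
    (φ.inst t).subst σ = (φ.subst (up σ)).inst (t.subst σ) := by
  rw [subst_up_inst, inst_eq, subst_subst]
  congr 1; funext n; cases n <;> rfl

/-- The variable `m` occurs free in `φ`. -/
def Occ : ℕ → Fml → Prop
  | _, bot => False
  | m, eq s t => m ∈ s.varFinset ∨ m ∈ t.varFinset
  | m, and φ ψ => Occ m φ ∨ Occ m ψ
  | m, or φ ψ => Occ m φ ∨ Occ m ψ
  | m, imp φ ψ => Occ m φ ∨ Occ m ψ
  | m, all φ => Occ (m + 1) φ
  | m, ex φ => Occ (m + 1) φ

end Fml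

theorem Tm.subst_congr (t : Tm) {σ τ : ℕ → Tm} (h : ∀ m ∈ t.varFinset, σ m = τ m) :
    t.subst σ = t.subst τ := by
  induction t with
  | var => exact h _ (by simp [Term.varFinset])
  | func f ts ih =>
    simp only [Term.subst]; congr 1; funext i
    refine ih i fun m hm => h m ?_
    simp only [Term.varFinset, Finset.mem_biUnion]
    exact ⟨i, by simp, hm⟩

theorem Tm.mem_varFinset_subst {t : Tm} {σ : ℕ → Tm} {m : ℕ} (h : m ∈ (t.subst σ).varFinset) :
    ∃ n ∈ t.varFinset, m ∈ (σ n).varFinset := by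
  induction t with
  | var a => exact ⟨a, by simp [Term.varFinset], h⟩
  | func f ts ih =>
    simp only [Term.subst, Term.varFinset, Finset.mem_biUnion] at h
    obtain ⟨i, -, hi⟩ := h
    obtain ⟨n, hn, hm⟩ := ih i hi
    exact ⟨n, by simp only [Term.varFinset, Finset.mem_biUnion]; exact ⟨i, by simp, hn⟩, hm⟩

theorem mem_varFinset_up {σ : ℕ → Tm} {m n : ℕ} (h : m + 1 ∈ (up σ n).varFinset) :
    ∃ k, n = k + 1 ∧ m ∈ (σ k).varFinset := by
  cases n with
  | zero => simp [up, v, Term.varFinset] at h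
  | succ k =>
    simp only [up, shiftT_eq_subst] at h
    obtain ⟨a, ha, hm⟩ := Tm.mem_varFinset_subst h
    simp only [Term.varFinset, Finset.mem_singleton, Nat.succ_inj] at hm
    exact ⟨k, rfl, hm ▸ ha⟩

namespace Fml

theorem subst_congr {φ : Fml} {σ τ : ℕ → Tm} (h : ∀ m, Occ m φ → σ m = τ m) :
    φ.subst σ = φ.subst τ := by
  have key : ∀ {φ : Fml} {σ τ : ℕ → Tm}, (∀ m, Occ (m + 1) φ → σ m = τ m) →
      ∀ m, Occ m φ → up σ m = up τ m := by
    intro φ σ τ h m hm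
    cases m with
    | zero => rfl
    | succ m => simp [up, h m hm]
  induction φ generalizing σ τ with
  | bot => rfl
  | eq s t =>
    simp only [subst]
    rw [Tm.subst_congr s fun m hm => h m (Or.inl hm), Tm.subst_congr t fun m hm => h m (Or.inr hm)]
  | and φ ψ h₁ h₂ | or φ ψ h₁ h₂ | imp φ ψ h₁ h₂ =>
    simp only [subst]
    rw [h₁ fun m hm => h m (Or.inl hm), h₂ fun m hm => h m (Or.inr hm)]
  | all φ ih => simp only [subst]; rw [ih (key h)]
  | ex φ ih => simp only [subst]; rw [ih (key h)]

theorem occ_subst {φ : Fml} {σ : ℕ → Tm} {m : ℕ} (h : Occ m (φ.subst σ)) :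
    ∃ n, Occ n φ ∧ m ∈ (σ n).varFinset := by
  induction φ generalizing σ m with
  | bot => exact h.elim
  | eq s t =>
    rcases h with h | h
    · obtain ⟨n, hn, hm⟩ := Tm.mem_varFinset_subst h; exact ⟨n, Or.inl hn, hm⟩
    · obtain ⟨n, hn, hm⟩ := Tm.mem_varFinset_subst h; exact ⟨n, Or.inr hn, hm⟩
  | and φ ψ h₁ h₂ | or φ ψ h₁ h₂ | imp φ ψ h₁ h₂ =>
    rcases h with h | h
    · obtain ⟨n, hn, hm⟩ := h₁ h; exact ⟨n, Or.inl hn, hm⟩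
    · obtain ⟨n, hn, hm⟩ := h₂ h; exact ⟨n, Or.inr hn, hm⟩
  | all φ ih | ex φ ih =>
    obtain ⟨n, hn, hm⟩ := ih h
    obtain ⟨k, rfl, hk⟩ := mem_varFinset_up hm
    exact ⟨k, hn, hk⟩

theorem lt_bound_of_occ {φ : Fml} {m : ℕ} (h : Occ m φ) : m < φ.bound := by
  induction φ generalizing m with
  | bot => exact h.elim
  | eq s t =>
    rcases h with h | h
    · exact lt_max_of_lt_left (Nat.lt_of_succ_le (Finset.le_sup (f := Nat.succ) h))
    · exact lt_max_of_lt_right (Nat.lt_of_succ_le (Finset.le_sup (f := Nat.succ) h))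
  | and φ ψ h₁ h₂ | or φ ψ h₁ h₂ | imp φ ψ h₁ h₂ =>
    rcases h with h | h
    · exact lt_max_of_lt_left (h₁ h)
    · exact lt_max_of_lt_right (h₂ h)
  | all φ ih | ex φ ih =>
    have := ih h
    simp only [bound]; omega

theorem occ_alls {n m : ℕ} {φ : Fml} (h : Occ m (alls n φ)) : Occ (m + n) φ := by
  induction n generalizing m with
  | zero => exact h
  | succ n ih => have := ih (m := m + 1) h; rwa [Nat.add_right_comm] at this

/-- Closures have no free variables. This is what later supplies the hypothesis that substitution
fixes every axiom of the theory. -/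
theorem closure_subst (φ : Fml) (σ : ℕ → Tm) : φ.closure.subst σ = φ.closure := by
  conv_rhs => rw [← subst_var φ.closure]
  refine subst_congr fun m hm => absurd (lt_bound_of_occ (occ_alls hm)) (by omega)

/-- The number of binders is iterated on a substitution. -/
theorem alls_subst (n : ℕ) (φ : Fml) (σ : ℕ → Tm) :
    (alls n φ).subst σ = alls n (φ.subst (up^[n] σ)) := by
  induction n generalizing σ with
  | zero => rfl
  | succ n ih => simp only [alls, subst, ih, Function.iterate_succ_apply]

theorem exs_subst (n : ℕ) (φ : Fml) (σ : ℕ → Tm) :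
    (exs n φ).subst σ = exs n (φ.subst (up^[n] σ)) := by
  induction n generalizing σ with
  | zero => rfl
  | succ n ih => simp only [exs, subst, ih, Function.iterate_succ_apply]

theorem QuantifierFree.subst {φ : Fml} (h : φ.QuantifierFree) (σ : ℕ → Tm) :
    (φ.subst σ).QuantifierFree := by
  induction φ with
  | bot => trivial
  | eq => trivial
  | and φ ψ h₁ h₂ | or φ ψ h₁ h₂ | imp φ ψ h₁ h₂ => exact ⟨h₁ h.1, h₂ h.2⟩
  | all => exact h
  | ex => exact h

end Fml

theorem sigmaF_piF_subst (k : ℕ) :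
    (∀ φ ∈ SigmaF k, ∀ σ, φ.subst σ ∈ SigmaF k) ∧ ∀ φ ∈ PiF k, ∀ σ, φ.subst σ ∈ PiF k := by
  induction k with
  | zero =>
    simp only [SigmaF, PiF, Set.mem_ofPred_eq]
    exact ⟨fun φ h σ => h.subst σ, fun φ h σ => h.subst σ⟩
  | succ k ih =>
    simp only [SigmaF, PiF, Set.mem_ofPred_eq]
    constructor
    · rintro _ ⟨n, φ, hn, hφ, rfl⟩ σ
      exact ⟨n, _, hn, ih.2 φ hφ _, Fml.exs_subst n φ σ⟩
    · rintro _ ⟨n, φ, hn, hφ, rfl⟩ σ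
      exact ⟨n, _, hn, ih.1 φ hφ _, Fml.alls_subst n φ σ⟩

-- Structural properties of derivations

theorem Deriv.weaken {T : Set Fml} {Γ Δ : List Fml} {φ : Fml} (h : Deriv T Γ φ)
    (hs : ∀ ψ ∈ Γ, ψ ∈ Δ) : Deriv T Δ φ := by
  have hcons : ∀ {Γ Δ : List Fml} {χ : Fml}, (∀ ψ ∈ Γ, ψ ∈ Δ) → ∀ ψ ∈ χ :: Γ, ψ ∈ χ :: Δ := by
    intro Γ Δ χ h ψ hψ
    rcases List.mem_cons.1 hψ with rfl | hψ
    · exact List.mem_cons_self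
    · exact List.mem_cons_of_mem _ (h _ hψ)
  have hmap : ∀ {Γ Δ : List Fml}, (∀ ψ ∈ Γ, ψ ∈ Δ) →
      ∀ ψ ∈ Γ.map Fml.shift, ψ ∈ Δ.map Fml.shift := by
    intro Γ Δ h ψ hψ
    obtain ⟨χ, hχ, rfl⟩ := List.mem_map.1 hψ
    exact List.mem_map_of_mem (h _ hχ)
  induction h generalizing Δ with
  | ax h => exact .ax h
  | hyp h => exact .hyp (hs _ h)
  | botE _ ih => exact .botE (ih hs)
  | andI _ _ h₁ h₂ => exact .andI (h₁ hs) (h₂ hs)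
  | andE₁ _ ih => exact .andE₁ (ih hs)
  | andE₂ _ ih => exact .andE₂ (ih hs)
  | orI₁ _ ih => exact .orI₁ (ih hs)
  | orI₂ _ ih => exact .orI₂ (ih hs)
  | orE _ _ _ h₁ h₂ h₃ => exact .orE (h₁ hs) (h₂ (hcons hs)) (h₃ (hcons hs))
  | impI _ ih => exact .impI (ih (hcons hs))
  | impE _ _ h₁ h₂ => exact .impE (h₁ hs) (h₂ hs)
  | allI _ ih => exact .allI (ih (hmap hs))
  | allE t _ ih => exact .allE t (ih hs)
  | exI t _ ih => exact .exI t (ih hs)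
  | exE _ _ h₁ h₂ => exact .exE (h₁ hs) (h₂ (hcons (hmap hs)))
  | eqI t => exact .eqI t
  | eqE φ _ _ h₁ h₂ => exact .eqE φ (h₁ hs) (h₂ hs)

/-- Induction on the derivation; under an eigenvariable the substitution becomes `up σ`, which
commutes with `shift`. The axioms must be fixed by substitution because they are not shifted there.
-/
theorem Deriv.subst {T : Set Fml} (hT : ∀ φ ∈ T, ∀ σ, φ.subst σ = φ) {Γ : List Fml} {φ : Fml}
    (h : Deriv T Γ φ) (σ : ℕ → Tm) : Deriv T (Γ.map fun ψ => ψ.subst σ) (φ.subst σ) := by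
  have hmap : ∀ (Γ : List Fml) (σ : ℕ → Tm), (Γ.map Fml.shift).map (fun ψ => ψ.subst (up σ)) =
      (Γ.map fun ψ => ψ.subst σ).map Fml.shift := by
    intro Γ σ
    simp only [List.map_map]
    congr 1; funext ψ; exact Fml.shift_subst_up ψ σ
  induction h generalizing σ with
  | ax h => rw [hT _ h]; exact .ax h
  | hyp h => exact .hyp (List.mem_map_of_mem (f := fun ψ : Fml => ψ.subst σ) h)
  | botE _ ih => exact .botE (ih σ)
  | andI _ _ h₁ h₂ => exact .andI (h₁ σ) (h₂ σ)
  | andE₁ _ ih => exact .andE₁ (ih σ)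
  | andE₂ _ ih => exact .andE₂ (ih σ)
  | orI₁ _ ih => exact .orI₁ (ih σ)
  | orI₂ _ ih => exact .orI₂ (ih σ)
  | orE _ _ _ h₁ h₂ h₃ => exact .orE (h₁ σ) (h₂ σ) (h₃ σ)
  | impI _ ih => exact .impI (ih σ)
  | impE _ _ h₁ h₂ => exact .impE (h₁ σ) (h₂ σ)
  | allI _ ih => exact .allI (hmap _ σ ▸ ih (up σ))
  | allE t _ ih => rw [Fml.inst_subst]; exact .allE _ (ih σ)
  | exI t _ ih => refine .exI (t.subst σ) ?_; rw [← Fml.inst_subst]; exact ih σ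
  | exE _ _ h₁ h₂ =>
    refine .exE (h₁ σ) ?_
    rw [← hmap, ← Fml.shift_subst_up]; exact h₂ (up σ)
  | eqI t => exact .eqI _
  | eqE φ _ _ h₁ h₂ =>
    rw [Fml.inst_subst]
    refine .eqE _ (h₁ σ) ?_
    rw [← Fml.inst_subst]; exact h₂ σ

/-- Derivability from a possibly infinite set of assumptions. -/
def SDeriv (T X : Set Fml) (φ : Fml) : Prop :=
  ∃ Γ : List Fml, (∀ ψ ∈ Γ, ψ ∈ X) ∧ Deriv T Γ φ

namespace SDeriv

variable {T X Y : Set Fml} {φ ψ χ : Fml}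

theorem mono (hXY : X ⊆ Y) (h : SDeriv T X φ) : SDeriv T Y φ :=
  let ⟨Γ, hΓ, d⟩ := h; ⟨Γ, fun _ hψ => hXY (hΓ _ hψ), d⟩

theorem hyp (h : φ ∈ X) : SDeriv T X φ := ⟨[φ], by simpa using h, .hyp (by simp)⟩

theorem map₁ (f : ∀ Γ, Deriv T Γ φ → Deriv T Γ ψ) (h : SDeriv T X φ) : SDeriv T X ψ :=
  let ⟨Γ, hΓ, d⟩ := h; ⟨Γ, hΓ, f Γ d⟩

theorem map₂ (f : ∀ Γ, Deriv T Γ φ → Deriv T Γ ψ → Deriv T Γ χ) (h₁ : SDeriv T X φ)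
    (h₂ : SDeriv T X ψ) : SDeriv T X χ := by
  obtain ⟨Γ, hΓ, d⟩ := h₁
  obtain ⟨Δ, hΔ, e⟩ := h₂
  refine ⟨Γ ++ Δ, fun ψ hψ => (List.mem_append.1 hψ).elim (hΓ _) (hΔ _), f _ ?_ ?_⟩
  · exact d.weaken fun _ h => List.mem_append_left _ h
  · exact e.weaken fun _ h => List.mem_append_right _ h

/-- The assumption `φ` can be listed first. -/
theorem exists_cons (h : SDeriv T (insert φ X) ψ) :
    ∃ Γ : List Fml, (∀ χ ∈ Γ, χ ∈ X) ∧ Deriv T (φ :: Γ) ψ := by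
  classical
  obtain ⟨Γ, hΓ, d⟩ := h
  refine ⟨Γ.filter (fun χ => decide (χ ≠ φ)), fun χ hχ => ?_, d.weaken fun χ hχ => ?_⟩
  · have := List.mem_filter.1 hχ
    exact (hΓ χ this.1).resolve_left (by simpa using this.2)
  · by_cases hc : χ = φ
    · simp [hc]
    · exact List.mem_cons_of_mem _ (List.mem_filter.2 ⟨hχ, by simpa using hc⟩)

theorem impI (h : SDeriv T (insert φ X) ψ) : SDeriv T X (Fml.imp φ ψ) :=
  let ⟨Γ, hΓ, d⟩ := h.exists_cons; ⟨Γ, hΓ, .impI d⟩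

theorem impE (h₁ : SDeriv T X (Fml.imp φ ψ)) (h₂ : SDeriv T X φ) : SDeriv T X ψ :=
  map₂ (fun _ => .impE) h₁ h₂

theorem cut (h₁ : SDeriv T X φ) (h₂ : SDeriv T (insert φ X) ψ) : SDeriv T X ψ :=
  h₂.impI.impE h₁

theorem orE (h : SDeriv T X (Fml.or φ ψ)) (h₁ : SDeriv T (insert φ X) χ)
    (h₂ : SDeriv T (insert ψ X) χ) : SDeriv T X χ := by
  -- The three premises come with three finite contexts. Packing two of them into a conjunction lets
  -- the binary `map₂` produce a common context.
  have h₃ := map₂ (fun _ => Deriv.andI) h h₁.impI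
  refine map₂ (fun Γ d e => ?_) h₃ h₂.impI
  have w : ∀ {α β : Fml}, Deriv T Γ β → Deriv T (α :: Γ) β :=
    fun d => d.weaken fun _ h => List.mem_cons_of_mem _ h
  exact .orE (.andE₁ d) (.impE (w (.andE₂ d)) (.hyp (by simp))) (.impE (w e) (.hyp (by simp)))

theorem subst (hT : ∀ φ ∈ T, ∀ σ, φ.subst σ = φ) (h : SDeriv T X φ) (σ : ℕ → Tm) :
    SDeriv T ((fun ψ => ψ.subst σ) '' X) (φ.subst σ) := by
  obtain ⟨Γ, hΓ, d⟩ := h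
  refine ⟨_, fun ψ hψ => ?_, d.subst hT σ⟩
  obtain ⟨χ, hχ, rfl⟩ := List.mem_map.1 hψ
  exact ⟨χ, hΓ χ hχ, rfl⟩

theorem exists_list_map {f : Fml → Fml} (h : SDeriv T (f '' X) φ) :
    ∃ Γ : List Fml, (∀ ψ ∈ Γ, ψ ∈ X) ∧ Deriv T (Γ.map f) φ := by
  obtain ⟨Γ, hΓ, d⟩ := h
  have : ∃ Δ : List Fml, (∀ ψ ∈ Δ, ψ ∈ X) ∧ Δ.map f = Γ := by
    clear d
    induction Γ with
    | nil => exact ⟨[], by simp, rfl⟩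
    | cons χ Γ ih =>
      obtain ⟨Δ, hΔ, rfl⟩ := ih fun ψ h => hΓ ψ (List.mem_cons_of_mem _ h)
      obtain ⟨χ', hχ', rfl⟩ := hΓ χ List.mem_cons_self
      exact ⟨χ' :: Δ, by simpa using ⟨hχ', hΔ⟩, rfl⟩
  obtain ⟨Δ, hΔ, rfl⟩ := this
  exact ⟨Δ, hΔ, d⟩

theorem allI (h : SDeriv T (Fml.shift '' X) φ) : SDeriv T X (Fml.all φ) :=
  let ⟨Γ, hΓ, d⟩ := h.exists_list_map; ⟨Γ, hΓ, .allI d⟩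

/-- Elimination of `∃` with a variable that does not occur elsewhere. -/
theorem exE_var (hT : ∀ φ ∈ T, ∀ σ, φ.subst σ = φ) {m : ℕ} (hX : ∀ χ ∈ X, ¬ Fml.Occ m χ)
    (hφ : ¬ Fml.Occ m (Fml.ex φ)) (hψ : ¬ Fml.Occ m ψ) (h : SDeriv T X (Fml.ex φ))
    (h' : SDeriv T (insert (φ.inst (v m)) X) ψ) : SDeriv T X ψ := by
  obtain ⟨Γ, hΓ, d⟩ := h'.exists_cons
  obtain ⟨Δ, hΔ, e⟩ := h
  -- This renaming sends the eigenvariable `m` to `0` and shifts all others, so it turns `φ.inst (v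
  -- m)` back into `φ` and acts as `shift` on formulas without `m`.
  let σ : ℕ → Tm := fun n => if n = m then v 0 else v (n + 1)
  have hσ : ∀ χ : Fml, ¬ Fml.Occ m χ → χ.subst σ = χ.shift := fun χ hχ =>
    Fml.subst_congr fun n hn => if_neg fun hnm : n = m => hχ (hnm ▸ hn)
  have hφσ : (φ.inst (v m)).subst σ = φ := by
    rw [Fml.inst_eq, Fml.subst_subst]
    conv_rhs => rw [← Fml.subst_var φ]
    refine Fml.subst_congr fun n hn => ?_
    cases n with
    | zero => simp [Term.subst, σ]
    | succ n =>
      have : n ≠ m := fun hnm : n = m => hφ (hnm ▸ hn)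
      simp [Term.subst, σ, this]
  have d' := d.subst hT σ
  rw [List.map_cons, hφσ, hσ ψ hψ] at d'
  refine ⟨Δ ++ Γ, fun χ hχ => (List.mem_append.1 hχ).elim (hΔ _) (hΓ _), .exE
    (e.weaken fun _ h => List.mem_append_left _ h) (d'.weaken fun χ hχ => ?_)⟩
  rcases List.mem_cons.1 hχ with rfl | hχ
  · exact List.mem_cons_self
  · obtain ⟨χ', hχ', rfl⟩ := List.mem_map.1 hχ
    refine List.mem_cons_of_mem _ (List.mem_map.2 ⟨χ', List.mem_append_right _ hχ', ?_⟩)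
    exact (hσ χ' (hX _ (hΓ _ hχ'))).symm

end SDeriv

-- Saturated sets and Kripke semantics

/-- The set `w` is deductively closed over `T`, consistent, prime and has witnesses. -/
structure Saturated (T : Set Fml) (w : Set Fml) : Prop where
  closed : ∀ φ, SDeriv T w φ → φ ∈ w
  bot : Fml.bot ∉ w
  or : ∀ φ ψ, Fml.or φ ψ ∈ w → φ ∈ w ∨ ψ ∈ w
  ex : ∀ φ, Fml.ex φ ∈ w → ∃ t, φ.inst t ∈ w

/-- A Kripke model of intuitionistic first-order logic with equality, over a category of worlds. -/
structure KModel where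
  W : Type
  Hom : W → W → Type
  id : ∀ w, Hom w w
  comp : ∀ {u w x}, Hom u w → Hom w x → Hom u x
  D : W → Type
  str : ∀ w, arithLang.Structure (D w)
  map : ∀ {w x}, Hom w x → D w → D x
  map_id : ∀ {w} (a : D w), map (id w) a = a
  map_comp : ∀ {u w x} (f : Hom u w) (g : Hom w x) (a : D u), map (comp f g) a = map g (map f a)
  map_fun : ∀ {w x} (f : Hom w x) {n} (F : PRSymb n) (a : Fin n → D w),
    map f (Structure.funMap (L := arithLang) F a) =
      Structure.funMap (L := arithLang) F fun i => map f (a i)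

attribute [instance] KModel.str
attribute [simp] KModel.map_id KModel.map_comp

namespace KModel

variable {M : KModel}

/-- The function denoted by a function symbol. -/
def fn {w : M.W} {n : ℕ} (F : PRSymb n) (a : Fin n → M.D w) : M.D w :=
  Structure.funMap (L := arithLang) F a

/-- The value of a term. -/
def val {w : M.W} (ρ : ℕ → M.D w) (t : Tm) : M.D w := t.realize ρ

/-- The environment `ρ`, moved along a morphism. -/
def mapEnv {w x : M.W} (f : M.Hom w x) (ρ : ℕ → M.D w) : ℕ → M.D x := fun i => M.map f (ρ i)

@[simp] theorem mapEnv_apply {w x : M.W} (f : M.Hom w x) (ρ : ℕ → M.D w) (i : ℕ) :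
    mapEnv f ρ i = M.map f (ρ i) := rfl

@[simp] theorem mapEnv_id {w : M.W} (ρ : ℕ → M.D w) : mapEnv (M.id w) ρ = ρ :=
  funext fun _ => M.map_id _

@[simp] theorem mapEnv_comp {u w x : M.W} (f : M.Hom u w) (g : M.Hom w x) (ρ : ℕ → M.D u) :
    mapEnv (M.comp f g) ρ = mapEnv g (mapEnv f ρ) :=
  funext fun _ => M.map_comp _ _ _

@[simp] theorem mapEnv_scons {w x : M.W} (f : M.Hom w x) (a : M.D w) (ρ : ℕ → M.D w) :
    mapEnv f (scons a ρ) = scons (M.map f a) (mapEnv f ρ) := comp_scons _ _ _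

@[simp] theorem val_v {w : M.W} (ρ : ℕ → M.D w) (i : ℕ) : val ρ (v i) = ρ i := rfl

@[simp] theorem val_app {w : M.W} (ρ : ℕ → M.D w) {n : ℕ} (F : PRSymb n) (ts : Fin n → Tm) :
    val ρ (app F ts) = fn F fun i => val ρ (ts i) := rfl

@[simp] theorem val_subst {w : M.W} (ρ : ℕ → M.D w) (t : Tm) (σ : ℕ → Tm) :
    val ρ (t.subst σ) = val (fun n => val ρ (σ n)) t := by
  simp [val]

theorem val_shiftT {w : M.W} (ρ : ℕ → M.D w) (t : Tm) :
    val ρ (shiftT t) = val (fun n => ρ (n + 1)) t := by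
  rw [shiftT_eq_subst, val_subst]; rfl

@[simp] theorem val_shiftT_scons {w : M.W} (a : M.D w) (ρ : ℕ → M.D w) (t : Tm) :
    val (scons a ρ) (shiftT t) = val ρ t := val_shiftT _ t

theorem map_fn {w x : M.W} (f : M.Hom w x) {n : ℕ} (F : PRSymb n) (a : Fin n → M.D w) :
    M.map f (fn F a) = fn F fun i => M.map f (a i) := M.map_fun f F a

theorem map_val {w x : M.W} (f : M.Hom w x) (ρ : ℕ → M.D w) (t : Tm) :
    M.map f (val ρ t) = val (mapEnv f ρ) t := by
  induction t with
  | var => rfl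
  | func F ts ih =>
    refine (M.map_fun f F _).trans ?_
    simp only [val] at ih
    simp only [val, Term.realize, ih]

/-- The formula `φ` is forced at the world `w` under the environment `ρ`. -/
def Forces (M : KModel) : Fml → (w : M.W) → (ℕ → M.D w) → Prop
  | .bot, _, _ => False
  | .eq s t, _, ρ => val ρ s = val ρ t
  | .and φ ψ, w, ρ => M.Forces φ w ρ ∧ M.Forces ψ w ρ
  | .or φ ψ, w, ρ => M.Forces φ w ρ ∨ M.Forces ψ w ρ
  | .imp φ ψ, w, ρ => ∀ x (f : M.Hom w x), M.Forces φ x (mapEnv f ρ) → M.Forces ψ x (mapEnv f ρ)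
  | .all φ, w, ρ => ∀ x (f : M.Hom w x) (a : M.D x), M.Forces φ x (scons a (mapEnv f ρ))
  | .ex φ, w, ρ => ∃ a : M.D w, M.Forces φ w (scons a ρ)

theorem Forces.mono {φ : Fml} {w x : M.W} {ρ : ℕ → M.D w} (h : M.Forces φ w ρ) (f : M.Hom w x) :
    M.Forces φ x (mapEnv f ρ) := by
  induction φ generalizing w x with
  | bot => exact h
  | eq s t => simp only [Forces, ← map_val] at h ⊢; rw [h]
  | and φ ψ h₁ h₂ => exact ⟨h₁ h.1 f, h₂ h.2 f⟩
  | or φ ψ h₁ h₂ => exact h.imp (h₁ · f) (h₂ · f)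
  | imp φ ψ h₁ h₂ => intro y g; rw [← mapEnv_comp]; exact h y _
  | all φ ih => intro y g a; rw [← mapEnv_comp]; exact h y _ a
  | ex φ ih =>
    obtain ⟨a, ha⟩ := h
    exact ⟨_, mapEnv_scons f a ρ ▸ ih ha f⟩

theorem val_up {w : M.W} (a : M.D w) (ρ : ℕ → M.D w) (σ : ℕ → Tm) :
    (fun n => val (scons a ρ) (up σ n)) = scons a fun n => val ρ (σ n) := by
  funext n
  cases n with
  | zero => rfl
  | succ n => simp [up]

@[simp] theorem forces_subst {φ : Fml} {σ : ℕ → Tm} {w : M.W} {ρ : ℕ → M.D w} :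
    M.Forces (φ.subst σ) w ρ ↔ M.Forces φ w fun n => val ρ (σ n) := by
  have key : ∀ {w x : M.W} (f : M.Hom w x) (ρ : ℕ → M.D w) (σ : ℕ → Tm),
      (fun n => val (mapEnv f ρ) (σ n)) = mapEnv f fun n => val ρ (σ n) := by
    intro w x f ρ σ; funext n; exact (map_val f ρ _).symm
  induction φ generalizing σ w with
  | bot => rfl
  | eq s t => simp [Fml.subst, Forces]
  | and φ ψ h₁ h₂ => simp [Fml.subst, Forces, h₁, h₂]
  | or φ ψ h₁ h₂ => simp [Fml.subst, Forces, h₁, h₂]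
  | imp φ ψ h₁ h₂ => simp [Fml.subst, Forces, h₁, h₂, key]
  | all φ ih => simp [Fml.subst, Forces, ih, val_up, key]
  | ex φ ih => simp [Fml.subst, Forces, ih, val_up]

@[simp] theorem forces_shift {φ : Fml} {w : M.W} {ρ : ℕ → M.D w} :
    M.Forces φ.shift w ρ ↔ M.Forces φ w fun n => ρ (n + 1) := forces_subst

@[simp] theorem forces_inst {φ : Fml} {t : Tm} {w : M.W} {ρ : ℕ → M.D w} :
    M.Forces (φ.inst t) w ρ ↔ M.Forces φ w (scons (val ρ t) ρ) := by
  rw [Fml.inst_eq, forces_subst, comp_scons (val ρ)]; rfl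

@[simp] theorem forces_bot {w : M.W} {ρ : ℕ → M.D w} : M.Forces .bot w ρ ↔ False := Iff.rfl

@[simp] theorem forces_eq {s t : Tm} {w : M.W} {ρ : ℕ → M.D w} :
    M.Forces (.eq s t) w ρ ↔ val ρ s = val ρ t := Iff.rfl

@[simp] theorem forces_and {φ ψ : Fml} {w : M.W} {ρ : ℕ → M.D w} :
    M.Forces (.and φ ψ) w ρ ↔ M.Forces φ w ρ ∧ M.Forces ψ w ρ := Iff.rfl

@[simp] theorem forces_or {φ ψ : Fml} {w : M.W} {ρ : ℕ → M.D w} :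
    M.Forces (.or φ ψ) w ρ ↔ M.Forces φ w ρ ∨ M.Forces ψ w ρ := Iff.rfl

theorem forces_imp {φ ψ : Fml} {w : M.W} {ρ : ℕ → M.D w} :
    M.Forces (.imp φ ψ) w ρ ↔
      ∀ x (f : M.Hom w x), M.Forces φ x (mapEnv f ρ) → M.Forces ψ x (mapEnv f ρ) := Iff.rfl

theorem forces_neg {φ : Fml} {w : M.W} {ρ : ℕ → M.D w} :
    M.Forces φ.neg w ρ ↔ ∀ x (f : M.Hom w x), ¬ M.Forces φ x (mapEnv f ρ) := Iff.rfl

theorem forces_all {φ : Fml} {w : M.W} {ρ : ℕ → M.D w} :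
    M.Forces (.all φ) w ρ ↔
      ∀ x (f : M.Hom w x) (a : M.D x), M.Forces φ x (scons a (mapEnv f ρ)) := Iff.rfl

@[simp] theorem forces_ex {φ : Fml} {w : M.W} {ρ : ℕ → M.D w} :
    M.Forces (.ex φ) w ρ ↔ ∃ a : M.D w, M.Forces φ w (scons a ρ) := Iff.rfl

theorem forces_iff {φ ψ : Fml} {w : M.W} {ρ : ℕ → M.D w} :
    M.Forces (.iff φ ψ) w ρ ↔
      ∀ x (f : M.Hom w x), M.Forces φ x (mapEnv f ρ) ↔ M.Forces ψ x (mapEnv f ρ) := by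
  simp only [Fml.iff, forces_and, forces_imp, iff_def, forall_and]

theorem Forces.imp_apply {φ ψ : Fml} {w : M.W} {ρ : ℕ → M.D w} (h : M.Forces (.imp φ ψ) w ρ)
    (hφ : M.Forces φ w ρ) : M.Forces ψ w ρ := by
  have := h w (M.id w); simp only [mapEnv_id] at this; exact this hφ

theorem Forces.all_apply {φ : Fml} {w : M.W} {ρ : ℕ → M.D w} (h : M.Forces (.all φ) w ρ)
    (a : M.D w) : M.Forces φ w (scons a ρ) := by
  simpa only [mapEnv_id] using h w (M.id w) a

theorem Forces.not_of_neg {φ : Fml} {w : M.W} {ρ : ℕ → M.D w} (h : M.Forces φ.neg w ρ) :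
    ¬ M.Forces φ w ρ := fun h' => Forces.imp_apply h h'

/-- The formula `φ` is forced everywhere. -/
def Valid (M : KModel) (φ : Fml) : Prop := ∀ w ρ, M.Forces φ w ρ

theorem valid_all {φ : Fml} : M.Valid (.all φ) ↔ M.Valid φ := by
  refine ⟨fun h w ρ => ?_, fun h w ρ x f a => h x _⟩
  rw [← scons_eta ρ]; exact (h w _).all_apply (ρ 0)

theorem valid_alls {n : ℕ} {φ : Fml} : M.Valid (Fml.alls n φ) ↔ M.Valid φ := by
  induction n with
  | zero => rfl
  | succ n ih => exact valid_all.trans ih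

theorem valid_closure {φ : Fml} : M.Valid φ.closure ↔ M.Valid φ := valid_alls

end KModel

-- Countability of the syntax

/-- A number for every function symbol. -/
def PRSymb.code : {n : ℕ} → PRSymb n → ℕ
  | _, .zero => Nat.pair 0 0
  | _, .succ => Nat.pair 1 0
  | _, .proj i => Nat.pair 2 i
  | _, .comp (m := m) f g =>
    Nat.pair 3 (Nat.pair m (Nat.pair f.code (Encodable.encode (List.ofFn fun i => (g i).code))))
  | _, .prec f g => Nat.pair 4 (Nat.pair f.code g.code)

theorem PRSymb.code_injective {n : ℕ} : Function.Injective (PRSymb.code (n := n)) := by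
  intro f
  induction f with
  | zero => intro g h; cases g <;> simp_all [code]
  | succ => intro g h; cases g <;> simp_all [code]
  | proj i =>
    intro g h
    cases g <;> simp_all [code, Fin.ext_iff]
  | comp f g ihf ihg =>
    intro h hh
    cases h with
    | comp f' g' =>
      simp only [code, Nat.pair_eq_pair, true_and] at hh
      -- The intermediate arity is invisible in the type of a composition; its presence in the code
      -- makes the two inner families comparable.
      obtain ⟨rfl, hf, hg⟩ := hh
      obtain rfl := ihf hf
      have := List.ofFn_injective (Encodable.encode_injective hg)
      congr 1; funext i; exact ihg i (congrFun this i)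
    | _ => simp [code] at hh
  | prec f g ihf ihg =>
    intro h hh
    cases h with
    | prec f' g' =>
      simp only [code, Nat.pair_eq_pair, true_and] at hh
      rw [ihf hh.1, ihg hh.2]
    | _ => simp [code] at hh

instance (n : ℕ) : Countable (PRSymb n) := PRSymb.code_injective.countable

instance : Countable Tm := by
  have : Countable (Σ n, arithLang.Functions n) := inferInstanceAs (Countable (Σ n, PRSymb n))
  have := Encodable.ofCountable (Σ n, arithLang.Functions n)
  exact Encodable.countable

/-- A number for every formula, from numbers for the terms. -/
def Fml.code (c : Tm → ℕ) : Fml → ℕ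
  | .bot => Nat.pair 0 0
  | .eq s t => Nat.pair 1 (Nat.pair (c s) (c t))
  | .and φ ψ => Nat.pair 2 (Nat.pair (φ.code c) (ψ.code c))
  | .or φ ψ => Nat.pair 3 (Nat.pair (φ.code c) (ψ.code c))
  | .imp φ ψ => Nat.pair 4 (Nat.pair (φ.code c) (ψ.code c))
  | .all φ => Nat.pair 5 (φ.code c)
  | .ex φ => Nat.pair 6 (φ.code c)

instance : Countable Fml := by
  obtain ⟨c, hc⟩ := Countable.exists_injective_nat Tm
  refine Function.Injective.countable (f := Fml.code c) fun φ => ?_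
  induction φ with
  | bot => intro ψ h; cases ψ <;> simp_all [Fml.code]
  | eq s t =>
    intro ψ h
    cases ψ <;> simp [Fml.code] at h
    rw [hc h.1, hc h.2]
  | and φ₁ φ₂ h₁ h₂ | or φ₁ φ₂ h₁ h₂ | imp φ₁ φ₂ h₁ h₂ =>
    intro ψ h
    cases ψ <;> simp [Fml.code] at h
    rw [h₁ h.1, h₂ h.2]
  | all φ ih | ex φ ih =>
    intro ψ h
    cases ψ <;> simp [Fml.code] at h
    rw [ih h]

instance : Nonempty Fml := ⟨.bot⟩

-- Extension to saturated sets

/-- `χ` is not derivable from `X`, and almost all odd variables are fresh for `X`. -/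
def Extendible (T : Set Fml) (χ : Fml) (X : Set Fml) : Prop :=
  ¬ SDeriv T X χ ∧ ∃ N, ∀ m, N ≤ m → Odd m → ∀ φ ∈ X, ¬ Fml.Occ m φ

/-- One stage of the Henkin construction: unless adding `ψ` would make `χ` derivable, `ψ` is added,
with a fresh variable as witness if it is existential. Only finitely many variables are used up, so
almost all odd ones stay fresh. -/
theorem Extendible.step {T : Set Fml} (hT : ∀ φ ∈ T, ∀ σ, φ.subst σ = φ) {χ : Fml} {X : Set Fml}
    (hX : Extendible T χ X) (ψ : Fml) : ∃ Y, X ⊆ Y ∧ Extendible T χ Y ∧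
      (SDeriv T (insert ψ X) χ ∨ (ψ ∈ Y ∧ ∀ φ, ψ = Fml.ex φ → ∃ t, φ.inst t ∈ Y)) := by
  by_cases hψ : SDeriv T (insert ψ X) χ
  · exact ⟨X, subset_rfl, hX, Or.inl hψ⟩
  obtain ⟨-, N, hN⟩ := hX
  have hfresh : ∀ m, max N ψ.bound ≤ m → Odd m → ∀ φ ∈ insert ψ X, ¬ Fml.Occ m φ := by
    rintro m hm ho φ (rfl | hφ) hocc
    · exact absurd (Fml.lt_bound_of_occ hocc) (not_lt.2 (le_trans (le_max_right _ _) hm))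
    · exact hN m (le_trans (le_max_left _ _) hm) ho φ hφ hocc
  by_cases hex : ∃ φ, ψ = Fml.ex φ
  · obtain ⟨φ, rfl⟩ := hex
    -- An odd variable that is fresh for the set and exceeds every variable of `∃ φ` and of `χ`.
    set m := 2 * (max (max N (Fml.ex φ).bound) χ.bound) + 1 with hm
    refine ⟨insert (φ.inst (v m)) (insert (Fml.ex φ) X),
      (Set.subset_insert _ _).trans (Set.subset_insert _ _), ⟨fun h => hψ ?_, ?_⟩, Or.inr ⟨?_, ?_⟩⟩
    · refine SDeriv.exE_var hT (m := m) (hfresh m (by omega) ⟨_, rfl⟩) ?_ ?_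
        (SDeriv.hyp (Set.mem_insert _ _)) h
      · exact hfresh m (by omega) ⟨_, rfl⟩ _ (Set.mem_insert _ _)
      · exact fun h => absurd (Fml.lt_bound_of_occ h) (by omega)
    · refine ⟨max (max N (Fml.ex φ).bound) (φ.inst (v m)).bound, fun n hn ho ξ hξ hocc => ?_⟩
      rcases hξ with rfl | hξ
      · exact absurd (Fml.lt_bound_of_occ hocc) (by omega)
      · exact hfresh n (by omega) ho ξ hξ hocc
    · exact Set.mem_insert_of_mem _ (Set.mem_insert _ _)
    · rintro φ' h
      cases h
      exact ⟨_, Set.mem_insert _ _⟩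
  · exact ⟨insert ψ X, Set.subset_insert _ _, ⟨hψ, _, hfresh⟩,
      Or.inr ⟨Set.mem_insert _ _, fun φ h => absurd ⟨φ, h⟩ hex⟩⟩

/-- The union of the stages avoids `χ` and is maximal with this property: a formula left out derives
`χ` when added. Closure follows by cut, primeness by `∨`-elimination, and the witnesses were added
along the way. -/
theorem Extendible.exists_saturated {T : Set Fml} (hT : ∀ φ ∈ T, ∀ σ, φ.subst σ = φ) {χ : Fml}
    {X : Set Fml} (hX : Extendible T χ X) : ∃ w, Saturated T w ∧ X ⊆ w ∧ χ ∉ w := by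
  obtain ⟨e, he⟩ := exists_surjective_nat Fml
  choose next h₁ h₂ h₃ using fun (Y : {Y // Extendible T χ Y}) ψ => Y.2.step hT ψ
  let S : ℕ → {Y // Extendible T χ Y} := fun n =>
    Nat.rec ⟨X, hX⟩ (fun n Y => ⟨next Y (e n), h₂ Y (e n)⟩) n
  have hmono : Monotone fun n => (S n).1 := monotone_nat_of_le_succ fun n => h₁ (S n) (e n)
  have hfin : ∀ Γ : List Fml, (∀ ψ ∈ Γ, ψ ∈ ⋃ n, (S n).1) → ∃ n, ∀ ψ ∈ Γ, ψ ∈ (S n).1 := by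
    intro Γ
    induction Γ with
    | nil => exact fun _ => ⟨0, by simp⟩
    | cons ψ Γ ih =>
      intro h
      obtain ⟨n, hn⟩ := ih fun ψ hψ => h ψ (List.mem_cons_of_mem _ hψ)
      obtain ⟨m, hm⟩ := Set.mem_iUnion.1 (h ψ List.mem_cons_self)
      refine ⟨max n m, fun ξ hξ => ?_⟩
      rcases List.mem_cons.1 hξ with rfl | hξ
      · exact hmono (le_max_right n m) hm
      · exact hmono (le_max_left n m) (hn ξ hξ)
  have hcons : ¬ SDeriv T (⋃ n, (S n).1) χ := by
    rintro ⟨Γ, hΓ, d⟩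
    obtain ⟨n, hn⟩ := hfin Γ hΓ
    exact (S n).2.1 ⟨Γ, hn, d⟩
  have hmax : ∀ ψ, ¬ SDeriv T (insert ψ (⋃ n, (S n).1)) χ → ψ ∈ (⋃ n, (S n).1) ∧
      ∀ φ, ψ = Fml.ex φ → ∃ t, φ.inst t ∈ ⋃ n, (S n).1 := by
    intro ψ hψ
    obtain ⟨n, rfl⟩ := he ψ
    rcases h₃ (S n) (e n) with h | ⟨h, h'⟩
    · exact absurd (h.mono (Set.insert_subset_insert (Set.subset_iUnion (fun n => (S n).1) n))) hψ
    · refine ⟨Set.mem_iUnion.2 ⟨n + 1, h⟩, fun φ hφ => ?_⟩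
      obtain ⟨t, ht⟩ := h' φ hφ
      exact ⟨t, Set.mem_iUnion.2 ⟨n + 1, ht⟩⟩
  have hclosed : ∀ φ, SDeriv T (⋃ n, (S n).1) φ → ¬ SDeriv T (insert φ (⋃ n, (S n).1)) χ :=
    fun φ h h' => hcons (h.cut h')
  refine ⟨⋃ n, (S n).1, ⟨fun φ h => (hmax φ (hclosed φ h)).1, fun h => ?_, fun φ ψ h => ?_,
    fun φ h => ?_⟩, Set.subset_iUnion (fun n => (S n).1) 0, fun h => hcons (.hyp h)⟩
  · exact hcons (SDeriv.map₁ (fun _ => .botE) (.hyp h))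
  · by_contra hc
    rw [not_or] at hc
    refine hcons (SDeriv.orE (.hyp h) ?_ ?_)
    · by_contra h'; exact hc.1 (hmax φ h').1
    · by_contra h'; exact hc.2 (hmax ψ h').1
  · exact (hmax _ (hclosed _ (.hyp h))).2 φ rfl

/-- The renaming of the variable `n` to `2 n`. -/
def double (n : ℕ) : Tm := v (2 * n)

/-- The set may already use every variable. Doubling the indices frees all the odd ones without
changing derivability, at the price that the extension is reached by a renaming instead of an
inclusion. Hence the worlds form a category rather than a preorder. -/
theorem exists_saturated {T : Set Fml} (hT : ∀ φ ∈ T, ∀ σ, φ.subst σ = φ) {χ : Fml} {X : Set Fml}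
    (h : ¬ SDeriv T X χ) :
    ∃ w, Saturated T w ∧ (∀ φ ∈ X, φ.subst double ∈ w) ∧ χ.subst double ∉ w := by
  have hext : Extendible T (χ.subst double) ((fun φ => φ.subst double) '' X) := by
    refine ⟨fun h' => h ?_, 0, ?_⟩
    · have hhalf : ∀ φ : Fml, (φ.subst double).subst (fun n => v (n / 2)) = φ := by
        intro φ
        rw [Fml.subst_subst]
        conv_rhs => rw [← Fml.subst_var φ]
        congr 1; funext n; simp [double, Term.subst]
      have := h'.subst hT fun n => v (n / 2)
      rw [hhalf, Set.image_image] at this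
      simpa only [hhalf, Set.image_id'] using this
    · rintro m - ho _ ⟨φ, -, rfl⟩ hocc
      obtain ⟨n, -, hn⟩ := Fml.occ_subst hocc
      simp only [double, Term.varFinset, Finset.mem_singleton] at hn
      exact absurd ho (by simp [hn])
  obtain ⟨w, hw, hXw, hχ⟩ := hext.exists_saturated hT
  exact ⟨w, hw, fun φ hφ => hXw ⟨φ, hφ, rfl⟩, hχ⟩

-- The canonical model and completeness

theorem shiftT_subst_scons (s t : Tm) : (shiftT s).subst (scons t fun n => v n) = s := by
  rw [shiftT_eq_subst, Tm.subst_subst]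
  exact Tm.subst_var s

namespace Saturated

variable {T w : Set Fml}

theorem eq_refl (h : Saturated T w) (t : Tm) : Fml.eq t t ∈ w :=
  h.closed _ ⟨[], by simp, .eqI t⟩

theorem eq_subst (h : Saturated T w) (φ : Fml) {s t : Tm} (e : Fml.eq s t ∈ w)
    (hs : φ.inst s ∈ w) : φ.inst t ∈ w :=
  h.closed _ (SDeriv.map₂ (fun _ => .eqE φ) (.hyp e) (.hyp hs))

theorem eq_symm (h : Saturated T w) {s t : Tm} (e : Fml.eq s t ∈ w) : Fml.eq t s ∈ w := by
  have := h.eq_subst (.eq (v 0) (shiftT s)) e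
  simp only [Fml.inst_eq, Fml.subst, shiftT_subst_scons] at this
  exact this (h.eq_refl s)

theorem eq_trans (h : Saturated T w) {s t u : Tm} (e : Fml.eq s t ∈ w) (e' : Fml.eq t u ∈ w) :
    Fml.eq s u ∈ w := by
  have := h.eq_subst (.eq (shiftT s) (v 0)) e'
  simp only [Fml.inst_eq, Fml.subst, shiftT_subst_scons] at this
  exact this e

/-- The arguments are replaced one at a time, since the equality rule rewrites a single term. -/
theorem eq_app (h : Saturated T w) {n : ℕ} (F : PRSymb n) {s t : Fin n → Tm}
    (e : ∀ i, Fml.eq (s i) (t i) ∈ w) : Fml.eq (app F s) (app F t) ∈ w := by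
  have key : ∀ k ≤ n, Fml.eq (app F s) (app F fun i => if i.1 < k then t i else s i) ∈ w := by
    intro k
    induction k with
    | zero => intro _; simpa using h.eq_refl (app F s)
    | succ k ih =>
      intro hk
      -- In this formula the arguments before position `k` are already replaced, and the variable
      -- `0` marks position `k`.
      let φ : Fml := .eq (shiftT (app F s)) (app F fun i =>
        if i.1 < k then shiftT (t i) else if i.1 = k then v 0 else shiftT (s i))
      have hφ : ∀ u, φ.inst u = .eq (app F s) (app F fun i =>
          if i.1 < k then t i else if i.1 = k then u else s i) := by
        intro u
        simp only [φ, Fml.inst_eq, Fml.subst, shiftT_subst_scons, Term.subst]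
        congr 2; funext i
        split_ifs <;> simp [shiftT_subst_scons, Term.subst]
      have h₁ := h.eq_subst φ (e ⟨k, hk⟩)
      rw [hφ, hφ] at h₁
      convert h₁ ?_ using 4 with i
      · by_cases h₁ : i.1 < k
        · simp [h₁, Nat.lt_succ_of_lt h₁]
        · by_cases h₂ : i.1 = k
          · obtain rfl : i = ⟨k, hk⟩ := Fin.ext h₂
            simp
          · simp [h₁, h₂, show ¬ i.1 < k + 1 by omega]
      · convert ih (by omega) using 4 with i
        by_cases h₁ : i.1 < k
        · simp [h₁]
        · by_cases h₂ : i.1 = k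
          · obtain rfl : i = ⟨k, hk⟩ := Fin.ext h₂
            simp
          · simp [h₁, h₂]
  have := key n le_rfl
  simpa using this

/-- Terms, up to equality in `w`. -/
def setoid (h : Saturated T w) : Setoid Tm where
  r s t := Fml.eq s t ∈ w
  iseqv := ⟨h.eq_refl, h.eq_symm, h.eq_trans⟩

/-- Classes of terms up to equality in `w`. -/
def Dom (h : Saturated T w) : Type := Quotient h.setoid

/-- The class of a term. -/
def cls (h : Saturated T w) (t : Tm) : h.Dom := Quotient.mk h.setoid t

theorem cls_eq_cls (h : Saturated T w) {s t : Tm} : h.cls s = h.cls t ↔ Fml.eq s t ∈ w :=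
  Quotient.eq (r := h.setoid)

theorem cls_surjective (h : Saturated T w) : Function.Surjective h.cls := Quotient.mk_surjective

noncomputable instance (h : Saturated T w) : arithLang.Structure h.Dom where
  funMap F a := h.cls (app F fun i => (h.cls_surjective (a i)).choose)
  RelMap r := r.elim

theorem funMap_cls (h : Saturated T w) {n : ℕ} (F : PRSymb n) (t : Fin n → Tm) :
    Structure.funMap (L := arithLang) F (fun i => h.cls (t i)) = h.cls (app F t) :=
  h.cls_eq_cls.2 (h.eq_app F fun i => h.cls_eq_cls.1 (h.cls_surjective (h.cls (t i))).choose_spec)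

theorem exists_cls_eq (h : Saturated T w) {ι : Type*} (a : ι → h.Dom) :
    ∃ t : ι → Tm, a = fun i => h.cls (t i) := by
  choose t ht using fun i => h.cls_surjective (a i)
  exact ⟨t, funext fun i => (ht i).symm⟩

/-- The action of a substitution on classes of terms. -/
def substDom (h : Saturated T w) {x : Set Fml} (hx : Saturated T x) (σ : ℕ → Tm)
    (hσ : ∀ φ ∈ w, φ.subst σ ∈ x) : h.Dom → hx.Dom :=
  Quotient.lift (fun t => hx.cls (t.subst σ)) fun _ _ e => hx.cls_eq_cls.2 (hσ _ e)

end Saturated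

/-- The canonical model of `T`: the worlds are the saturated sets of formulas, the morphisms are
the substitutions between them, and the elements are the terms up to equality. -/
noncomputable def canonicalModel (T : Set Fml) : KModel where
  W := {w // Saturated T w}
  Hom w x := {σ : ℕ → Tm // ∀ φ ∈ w.1, φ.subst σ ∈ x.1}
  id w := ⟨fun n => v n, fun φ h => by rwa [Fml.subst_var]⟩
  comp σ τ := ⟨fun n => (σ.1 n).subst τ.1, fun φ h => by
    rw [← Fml.subst_subst]; exact τ.2 _ (σ.2 _ h)⟩
  D w := w.2.Dom
  str w := inferInstance
  map {w x} σ := w.2.substDom x.2 σ.1 σ.2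
  map_id {w} a := by
    obtain ⟨t, rfl⟩ := w.2.cls_surjective a
    exact congrArg w.2.cls (Tm.subst_var t)
  map_comp {u w x} σ τ a := by
    obtain ⟨t, rfl⟩ := u.2.cls_surjective a
    exact congrArg x.2.cls (Tm.subst_subst t _ _).symm
  map_fun {w x} σ n F a := by
    obtain ⟨t, rfl⟩ := w.2.exists_cls_eq a
    rw [Saturated.funMap_cls]
    exact (Saturated.funMap_cls x.2 F fun i => (t i).subst σ.1).symm

namespace canonicalModel

variable {T : Set Fml}

/-- The set of formulas that is the world `w`. -/
def theory (w : (canonicalModel T).W) : Set Fml := Subtype.val w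

theorem saturated (w : (canonicalModel T).W) : Saturated T (theory w) := Subtype.property w

/-- The world given by a saturated set. -/
def world {w : Set Fml} (h : Saturated T w) : (canonicalModel T).W := ⟨w, h⟩

/-- The class of the term `t` at the world `w`. -/
def elt (w : (canonicalModel T).W) (t : Tm) : (canonicalModel T).D w := (saturated w).cls t

theorem elt_eq_elt {w : (canonicalModel T).W} {s t : Tm} :
    elt w s = elt w t ↔ Fml.eq s t ∈ theory w := (saturated w).cls_eq_cls

theorem elt_surjective (w : (canonicalModel T).W) : Function.Surjective (elt w) :=
  (saturated w).cls_surjective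

theorem exists_elt_eq {w : (canonicalModel T).W} (ρ : ℕ → (canonicalModel T).D w) :
    ∃ σ : ℕ → Tm, ρ = fun n => elt w (σ n) := (saturated w).exists_cls_eq ρ

/-- The substitution that is the morphism `f`. -/
def homSubst {w x : (canonicalModel T).W} (f : (canonicalModel T).Hom w x) : ℕ → Tm :=
  Subtype.val f

theorem mem_of_hom {w x : (canonicalModel T).W} (f : (canonicalModel T).Hom w x) {φ : Fml}
    (h : φ ∈ theory w) : φ.subst (homSubst f) ∈ theory x := Subtype.property f φ h

/-- The morphism given by a substitution. -/
def hom {w x : (canonicalModel T).W} (σ : ℕ → Tm) (h : ∀ φ ∈ theory w, φ.subst σ ∈ theory x) :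
    (canonicalModel T).Hom w x := ⟨σ, h⟩

@[simp] theorem homSubst_hom {w x : (canonicalModel T).W} (σ : ℕ → Tm)
    (h : ∀ φ ∈ theory w, φ.subst σ ∈ theory x) : homSubst (hom σ h) = σ := rfl

theorem mapEnv_elt {w x : (canonicalModel T).W} (f : (canonicalModel T).Hom w x) (σ : ℕ → Tm) :
    KModel.mapEnv f (fun n => elt w (σ n)) = fun n => elt x ((σ n).subst (homSubst f)) := rfl

theorem val_elt (w : (canonicalModel T).W) (σ : ℕ → Tm) (t : Tm) :
    KModel.val (fun n => elt w (σ n)) t = elt w (t.subst σ) := by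
  induction t with
  | var => rfl
  | func F ts ih =>
    refine Eq.trans ?_ ((saturated w).funMap_cls F fun i => (ts i).subst σ)
    exact congrArg (Structure.funMap (L := arithLang) F) (funext ih)

/-- The truth lemma. In the cases `→` and `∀`, a formula that is not in the world is not derivable
from it, so `exists_saturated` gives a later world that refutes it; in the cases `∨` and `∃`,
primeness and witnesses are used. -/
theorem forces_iff_mem (hT : ∀ φ ∈ T, ∀ σ, φ.subst σ = φ) (φ : Fml) (w : (canonicalModel T).W)
    (σ : ℕ → Tm) :
    (canonicalModel T).Forces φ w (fun n => elt w (σ n)) ↔ φ.subst σ ∈ theory w := by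
  induction φ generalizing w σ with
  | bot => exact ⟨fun h => h.elim, fun h => (saturated w).bot h⟩
  | eq s t =>
    rw [KModel.forces_eq, val_elt, val_elt]
    exact elt_eq_elt
  | and φ ψ h₁ h₂ =>
    rw [KModel.forces_and, h₁, h₂]
    refine ⟨fun h => (saturated w).closed _ (SDeriv.map₂ (fun _ => .andI) (.hyp h.1) (.hyp h.2)),
      fun h => ⟨(saturated w).closed _ ?_, (saturated w).closed _ ?_⟩⟩
    · exact SDeriv.map₁ (fun _ => .andE₁) (.hyp h)
    · exact SDeriv.map₁ (fun _ => .andE₂) (.hyp h)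
  | or φ ψ h₁ h₂ =>
    rw [KModel.forces_or, h₁, h₂]
    refine ⟨fun h => (saturated w).closed _ ?_, fun h => (saturated w).or _ _ h⟩
    rcases h with h | h
    · exact SDeriv.map₁ (fun _ => .orI₁) (.hyp h)
    · exact SDeriv.map₁ (fun _ => .orI₂) (.hyp h)
  | imp φ ψ h₁ h₂ =>
    rw [KModel.forces_imp]
    constructor
    · intro h
      by_contra hc
      have hX : ¬ SDeriv T (insert (φ.subst σ) (theory w)) (ψ.subst σ) := fun hd =>
        hc ((saturated w).closed _ hd.impI)
      obtain ⟨x, hx, hwx, hψ⟩ := exists_saturated hT hX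
      have := h (world hx) (hom double fun φ hφ => hwx φ (Set.mem_insert_of_mem _ hφ))
      rw [mapEnv_elt, h₁, h₂, ← Fml.subst_subst, ← Fml.subst_subst] at this
      exact hψ (this (hwx _ (Set.mem_insert _ _)))
    · intro h x f
      rw [mapEnv_elt, h₁, h₂, ← Fml.subst_subst, ← Fml.subst_subst]
      exact fun hφ => (saturated x).closed _ (SDeriv.impE (.hyp (mem_of_hom f h)) (.hyp hφ))
  | all φ ih =>
    rw [KModel.forces_all]
    constructor
    · intro h
      by_contra hc
      have hX : ¬ SDeriv T (Fml.shift '' theory w) (φ.subst (up σ)) := fun hd =>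
        hc ((saturated w).closed _ hd.allI)
      obtain ⟨x, hx, hwx, hφ⟩ := exists_saturated hT hX
      -- The old variables are first shifted past the eigenvariable and then doubled; the
      -- eigenvariable itself stays at index `0`.
      have hx' : ∀ φ ∈ theory w, φ.subst (fun n => double (n + 1)) ∈ theory (world hx) := by
        intro φ hφ
        have := hwx _ (Set.mem_image_of_mem _ hφ)
        rwa [Fml.shift, Fml.subst_subst] at this
      have := h (world hx) (hom _ hx') (elt _ (v 0))
      rw [mapEnv_elt, ← comp_scons (elt (world hx)), ih, homSubst_hom] at this
      have he : (scons (v 0) fun i => (σ i).subst fun n => double (n + 1)) =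
          fun n => (up σ n).subst double := by
        funext n
        cases n with
        | zero => rfl
        | succ n => simp only [scons_succ, up, shiftT_eq_subst, Tm.subst_subst]; rfl
      rw [he, ← Fml.subst_subst] at this
      exact hφ this
    · intro h x f a
      obtain ⟨t, rfl⟩ := elt_surjective x a
      rw [mapEnv_elt, ← comp_scons (elt x), ih, ← Fml.subst_up_inst, ← up_comp,
        ← Fml.subst_subst]
      exact (saturated x).closed _ (SDeriv.map₁ (fun _ => .allE t) (.hyp (mem_of_hom f h)))
  | ex φ ih =>
    rw [KModel.forces_ex]
    constructor
    · rintro ⟨a, ha⟩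
      obtain ⟨t, rfl⟩ := elt_surjective w a
      rw [← comp_scons (elt w), ih, ← Fml.subst_up_inst] at ha
      exact (saturated w).closed _ (SDeriv.map₁ (fun _ => .exI t) (.hyp ha))
    · intro h
      obtain ⟨t, ht⟩ := (saturated w).ex _ h
      refine ⟨elt w t, ?_⟩
      rwa [← comp_scons (elt w), ih, ← Fml.subst_up_inst]

/-- Soundness and completeness for the canonical model. -/
theorem valid_iff (hT : ∀ φ ∈ T, ∀ σ, φ.subst σ = φ) (φ : Fml) :
    (canonicalModel T).Valid φ ↔ Deriv T [] φ := by
  constructor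
  · intro h
    by_contra hc
    have hX : ¬ SDeriv T ∅ φ := by
      rintro ⟨Γ, hΓ, d⟩
      obtain rfl : Γ = [] := List.eq_nil_iff_forall_not_mem.2 fun ψ hψ => hΓ ψ hψ
      exact hc d
    obtain ⟨w, hw, -, hφ⟩ := exists_saturated hT hX
    exact hφ ((forces_iff_mem hT φ (world hw) double).1 (h _ _))
  · intro h w ρ
    obtain ⟨σ, rfl⟩ := exists_elt_eq ρ
    rw [forces_iff_mem hT]
    exact (saturated w).closed _ ⟨[], by simp, h.subst hT σ⟩

end canonicalModel

-- Validity and provability over `HA`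

theorem addPrinciple_HA_subst {P : Set Fml} :
    ∀ φ ∈ addPrinciple HA P, ∀ σ, φ.subst σ = φ := by
  rintro _ (⟨φ, -, rfl⟩ | ⟨φ, -, rfl⟩) σ <;> exact Fml.closure_subst φ σ

/-- All instances of the formulas in `P` are forced. -/
def KModel.ValidSet (M : KModel) (P : Set Fml) : Prop := ∀ φ ∈ P, M.Valid φ

theorem provable_of_valid {P : Set Fml} {φ : Fml}
    (h : (canonicalModel (addPrinciple HA P)).Valid φ) : Provable (addPrinciple HA P) φ :=
  (canonicalModel.valid_iff addPrinciple_HA_subst _).1 (KModel.valid_closure.2 h)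

theorem canonicalModel_validSet (P : Set Fml) :
    (canonicalModel (addPrinciple HA P)).ValidSet P := fun φ hφ =>
  KModel.valid_closure.1 ((canonicalModel.valid_iff addPrinciple_HA_subst _).2
    (.ax (Or.inr ⟨φ, hφ, rfl⟩)))

theorem canonicalModel_validSet_HA (P : Set Fml) :
    (canonicalModel (addPrinciple HA P)).ValidSet {φ | HAAxiomBody φ} := fun φ hφ =>
  KModel.valid_closure.1 ((canonicalModel.valid_iff addPrinciple_HA_subst _).2
    (.ax (Or.inl ⟨φ, hφ, rfl⟩)))

theorem comp_vecCons {α β : Type*} (g : α → β) {n : ℕ} (a : α) (u : Fin n → α) :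
    (fun i => g (Matrix.vecCons a u i)) = Matrix.vecCons (g a) fun i => g (u i) := by
  funext i
  cases i using Fin.cases <;> rfl

theorem comp_finCons {α β : Type*} (g : α → β) {n : ℕ} (a : α) (u : Fin n → α) :
    (fun i => g ((Fin.cons a u : Fin (n + 1) → α) i)) = Fin.cons (g a) fun i => g (u i) := by
  funext i
  cases i using Fin.cases <;> rfl

theorem comp_vecEmpty {α β : Type*} (g : α → β) (u : Fin 0 → α) :
    (fun i => g (u i)) = ![] := Subsingleton.elim _ _

-- Elementary arithmetic inside a Kripke model

namespace KModel

/-- The model forces the axioms of Heyting arithmetic. -/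
class IsHA (M : KModel) : Prop where
  valid : M.ValidSet {φ | HAAxiomBody φ}

instance (P : Set Fml) : (canonicalModel (addPrinciple HA P)).IsHA :=
  ⟨canonicalModel_validSet_HA P⟩

variable {M : KModel} {w x : M.W}

/-- The element `0`. -/
def Z : M.D w := fn .zero ![]

/-- The successor of an element. -/
def S (a : M.D w) : M.D w := fn .succ ![a]

/-- The order relation. -/
def Lt (a b : M.D w) : Prop := fn rsubSymb ![b, S a] = Z

@[simp] theorem val_zeroT (ρ : ℕ → M.D w) : val ρ zeroT = Z := by
  simp only [zeroT, val_app, comp_vecEmpty]; rfl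

@[simp] theorem val_succT (ρ : ℕ → M.D w) (t : Tm) : val ρ (succT t) = S (val ρ t) := by
  simp only [succT, val_app, comp_vecCons, comp_vecEmpty]; rfl

@[simp] theorem map_Z (f : M.Hom w x) : M.map f Z = Z := by
  simp only [Z, map_fn, comp_vecEmpty]

@[simp] theorem map_S (f : M.Hom w x) (a : M.D w) : M.map f (S a) = S (M.map f a) := by
  simp only [S, map_fn, comp_vecCons, comp_vecEmpty]

@[simp] theorem forces_lt {s t : Tm} {ρ : ℕ → M.D w} :
    M.Forces (Fml.lt s t) w ρ ↔ Lt (val ρ s) (val ρ t) := by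
  simp only [Fml.lt, forces_eq, val_app, comp_vecCons, comp_vecEmpty, val_succT, val_zeroT, Lt]

@[simp] theorem forces_instSucc {φ : Fml} {ρ : ℕ → M.D w} :
    M.Forces φ.instSucc w ρ ↔ M.Forces φ w (scons (S (ρ 0)) fun n => ρ (n + 1)) := by
  rw [Fml.instSucc_eq, forces_subst, comp_scons (val ρ), val_succT]; rfl

variable [M.IsHA]

theorem forces_axiom {φ : Fml} (h : HAAxiomBody φ) (ρ : ℕ → M.D w) : M.Forces φ w ρ :=
  IsHA.valid φ h w ρ

theorem S_ne_Z (a : M.D w) : S a ≠ Z := by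
  simpa using (forces_axiom .succ_ne_zero fun _ => a).not_of_neg

theorem S_injective : Function.Injective (S : M.D w → M.D w) := by
  intro a b h
  simpa using (forces_axiom .succ_inj (scons a fun _ => b)).imp_apply (by simpa using h)

@[simp] theorem S_inj {a b : M.D w} : S a = S b ↔ a = b := S_injective.eq_iff

/-- Extend a finite sequence by zeros. -/
def extend {n : ℕ} (a : Fin n → M.D w) (i : ℕ) : M.D w := if h : i < n then a ⟨i, h⟩ else Z

omit [M.IsHA] in
@[simp] theorem extend_fin {n : ℕ} (a : Fin n → M.D w) (i : Fin n) : extend a i = a i := by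
  simp [extend]

theorem fn_proj {n : ℕ} (i : Fin n) (a : Fin n → M.D w) : fn (.proj i) a = a i := by
  simpa using forces_axiom (.proj i) (extend a)

theorem fn_comp {m n : ℕ} (f : PRSymb m) (g : Fin m → PRSymb n) (a : Fin n → M.D w) :
    fn (.comp f g) a = fn f fun i => fn (g i) a := by
  simpa using forces_axiom (.comp f g) (extend a)

theorem fn_prec_zero {n : ℕ} (f : PRSymb n) (g : PRSymb (n + 2)) (a : Fin n → M.D w) :
    fn (.prec f g) (Fin.cons Z a) = fn f a := by
  simpa [comp_finCons] using forces_axiom (.prec_zero f g) (scons Z (extend a))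

theorem fn_prec_succ {n : ℕ} (f : PRSymb n) (g : PRSymb (n + 2)) (b : M.D w)
    (a : Fin n → M.D w) : fn (.prec f g) (Fin.cons (S b) a) =
      fn g (Fin.cons b (Fin.cons (fn (.prec f g) (Fin.cons b a)) a)) := by
  simpa [comp_finCons] using forces_axiom (.prec_succ f g) (scons b (extend a))

/-- Induction for a formula, at all worlds. -/
theorem valid_of_induction (φ : Fml) (h₀ : ∀ w ρ, M.Forces φ w (scons Z ρ))
    (h₁ : ∀ w ρ a, M.Forces φ w (scons a ρ) → M.Forces φ w (scons (S a) ρ)) : M.Valid φ := by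
  intro w ρ
  have := (forces_axiom (.induction φ) fun i => ρ (i + 1)).imp_apply
    ⟨by simpa using h₀ w _, fun x f a y g h => ?_⟩
  · rw [← scons_eta ρ]; exact this.all_apply (ρ 0)
  · rw [mapEnv_scons, ← mapEnv_comp] at h ⊢
    exact forces_instSucc.2 (h₁ _ _ _ h)

/-- Induction for a predicate that is expressed by a formula. -/
theorem induction_on (φ : Fml) {P : ∀ w, (ℕ → M.D w) → M.D w → Prop}
    (hφ : ∀ w ρ a, M.Forces φ w (scons a ρ) ↔ P w ρ a) (h₀ : ∀ w ρ, P w ρ Z)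
    (h₁ : ∀ w ρ a, P w ρ a → P w ρ (S a)) (w : M.W) (ρ : ℕ → M.D w) (a : M.D w) : P w ρ a := by
  rw [← hφ]
  refine valid_of_induction φ (fun w ρ => (hφ w ρ _).2 (h₀ w ρ)) (fun w ρ a h => ?_) w _
  rw [hφ] at h ⊢
  exact h₁ w ρ a h

theorem eq_Z_or_eq_S (a : M.D w) : a = Z ∨ ∃ b, a = S b :=
  induction_on (P := fun _ _ a => a = Z ∨ ∃ b, a = S b)
    (.or (.eq (v 0) zeroT) (.ex (.eq (v 1) (succT (v 0))))) (by simp)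
    (fun _ _ => Or.inl rfl) (fun _ _ a _ => Or.inr ⟨a, rfl⟩) w (fun _ => Z) a

/-- Equality is decidable in `HA`: numbers are either equal or stay unequal at all later worlds.
Hence distinct elements are never identified. -/
theorem map_injective (f : M.Hom w x) : Function.Injective (M.map f) := by
  -- Induction on `a` with `b` universally quantified inside, so that the step can pass to the
  -- predecessor of `b`.
  have key : ∀ w (_ : ℕ → M.D w) (a : M.D w), ∀ x (f : M.Hom w x) (b : M.D x),
      M.map f a = b ∨ ∀ y (g : M.Hom x y), M.map g (M.map f a) ≠ M.map g b := by
    refine induction_on (.all (.or (.eq (v 1) (v 0)) (.neg (.eq (v 1) (v 0)))))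
      (by simp [forces_all, forces_neg]) ?_ ?_
    · intro w _ x f b
      rcases eq_Z_or_eq_S b with rfl | ⟨b, rfl⟩
      · simp
      · exact Or.inr fun y g h => S_ne_Z _ (by simpa using h.symm)
    · intro w _ a h x f b
      rcases eq_Z_or_eq_S b with rfl | ⟨b, rfl⟩
      · exact Or.inr fun y g h => S_ne_Z _ (by simpa using h)
      · simpa using h x f b
  intro a b h
  rcases key w (fun _ => Z) a w (M.id w) b with h' | h'
  · simpa using h'
  · exact absurd (by simpa using h) (h' x f)

@[simp] theorem map_inj (f : M.Hom w x) {a b : M.D w} : M.map f a = M.map f b ↔ a = b :=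
  (map_injective f).eq_iff

/-- Transitions reflect equations because they are injective, so quantifier-free formulas do not
change truth value along morphisms. -/
theorem forces_mapEnv_iff {φ : Fml} (hφ : φ.QuantifierFree) (f : M.Hom w x) {ρ : ℕ → M.D w} :
    M.Forces φ x (mapEnv f ρ) ↔ M.Forces φ w ρ := by
  induction φ generalizing w x with
  | bot => rfl
  | eq s t => simp [← map_val]
  | and φ ψ h₁ h₂ => simp [h₁ hφ.1, h₂ hφ.2]
  | or φ ψ h₁ h₂ => simp [h₁ hφ.1, h₂ hφ.2]
  | imp φ ψ h₁ h₂ =>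
    simp only [forces_imp, ← mapEnv_comp, h₁ hφ.1, h₂ hφ.2]
    exact ⟨fun h _ _ => h x (M.id x), fun h _ _ => h w (M.id w)⟩
  | all => exact hφ.elim
  | ex => exact hφ.elim

theorem forces_imp_qf {φ ψ : Fml} (hφ : φ.QuantifierFree) {ρ : ℕ → M.D w} :
    M.Forces (.imp φ ψ) w ρ ↔ (M.Forces φ w ρ → M.Forces ψ w ρ) := by
  refine ⟨fun h => h.imp_apply, fun h x f h' => (h ?_).mono f⟩
  rwa [forces_mapEnv_iff hφ] at h'

@[simp] theorem forces_lt_imp {s t : Tm} {φ : Fml} {ρ : ℕ → M.D w} :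
    M.Forces (.imp (.lt s t) φ) w ρ ↔ (Lt (val ρ s) (val ρ t) → M.Forces φ w ρ) := by
  rw [← forces_lt]; exact forces_imp_qf (φ := .lt s t) trivial

theorem fn_pred_Z : fn predSymb ![Z] = (Z : M.D w) :=
  (fn_prec_zero _ _ ![]).trans rfl

theorem fn_pred_S (a : M.D w) : fn predSymb ![S a] = a :=
  (fn_prec_succ _ _ a ![]).trans (fn_proj _ _)

theorem fn_rsub_Z (a : M.D w) : fn rsubSymb ![Z, a] = a :=
  (fn_prec_zero _ _ ![a]).trans (fn_proj _ _)

theorem fn_rsub_S (a b : M.D w) :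
    fn rsubSymb ![S b, a] = fn predSymb ![fn rsubSymb ![b, a] ] := by
  refine (fn_prec_succ _ _ b ![a]).trans ((fn_comp _ _ _).trans ?_)
  rw [comp_vecCons fun g => fn g _, comp_vecEmpty fun g => fn g _, fn_proj]
  rfl

@[simp] theorem fn_rsub_S_S (a b : M.D w) :
    fn rsubSymb ![S b, S a] = fn rsubSymb ![b, a] :=
  induction_on (P := fun _ ρ b => fn rsubSymb ![S b, S (ρ 0)] = fn rsubSymb ![b, ρ 0])
    (.eq (app rsubSymb ![succT (v 0), succT (v 1)]) (app rsubSymb ![v 0, v 1]))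
    (fun w ρ a => by simp only [forces_eq, val_app, comp_vecCons, comp_vecEmpty, val_succT, val_v,
      scons_zero, scons_succ])
    (fun w ρ => by rw [fn_rsub_S, fn_rsub_Z, fn_pred_S, fn_rsub_Z])
    (fun w ρ b h => by rw [fn_rsub_S, h, ← fn_rsub_S]) w (fun _ => a) b

theorem fn_rsub_right_Z (b : M.D w) : fn rsubSymb ![b, Z] = Z :=
  induction_on (P := fun _ _ b => fn rsubSymb ![b, Z] = Z)
    (.eq (app rsubSymb ![v 0, zeroT]) zeroT)
    (fun w ρ a => by simp only [forces_eq, val_app, comp_vecCons, comp_vecEmpty, val_v, val_zeroT,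
      scons_zero])
    (fun w ρ => fn_rsub_Z _)
    (fun w ρ b h => by rw [fn_rsub_S, h, fn_pred_Z]) w (fun _ => Z) b

@[simp] theorem not_lt_Z (a : M.D w) : ¬ Lt a Z := by
  unfold Lt; rw [fn_rsub_Z]; exact S_ne_Z a

@[simp] theorem Z_lt_S (b : M.D w) : Lt Z (S b) := by
  unfold Lt; rw [fn_rsub_S_S]; exact fn_rsub_right_Z b

@[simp] theorem S_lt_S {a b : M.D w} : Lt (S a) (S b) ↔ Lt a b := by
  unfold Lt; rw [fn_rsub_S_S]

/-- Induction on `b` with `a` universally quantified; a predicate of this shape has to range over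
all later worlds to be expressed by a formula. -/
theorem lt_S_iff {a b : M.D w} : Lt a (S b) ↔ Lt a b ∨ a = b := by
  have := induction_on (M := M) (P := fun w _ b => ∀ x (f : M.Hom w x) (a : M.D x),
      Lt a (S (M.map f b)) ↔ Lt a (M.map f b) ∨ a = M.map f b)
    (.all (.iff (.lt (v 0) (succT (v 1))) (.or (.lt (v 0) (v 1)) (.eq (v 0) (v 1))))) ?_ ?_ ?_
    w (fun _ => Z) b w (M.id w) a
  · simpa using this
  · intro w ρ b
    simp only [forces_all, forces_iff]
    constructor
    · intro h x f a
      simpa using h x f a x (M.id x)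
    · intro h x f a y g
      simpa using h y (M.comp f g) (M.map g a)
  · intro w _ x f a
    rcases eq_Z_or_eq_S a with rfl | ⟨a, rfl⟩
    · simp
    · simp [S_ne_Z]
  · intro w _ b h x f a
    rcases eq_Z_or_eq_S a with rfl | ⟨a, rfl⟩
    · simp
    · simpa using h x f a

theorem lt_S_self (a : M.D w) : Lt a (S a) := lt_S_iff.2 (Or.inr rfl)

@[simp] theorem map_lt (f : M.Hom w x) {a b : M.D w} : Lt (M.map f a) (M.map f b) ↔ Lt a b := by
  have := forces_mapEnv_iff (φ := .lt (v 0) (v 1)) trivial f (ρ := scons a fun _ => b)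
  simpa using this

theorem Lt.trans {a b c : M.D w} (h₁ : Lt a b) (h₂ : Lt b c) : Lt a c := by
  have key := induction_on (M := M) (P := fun w ρ c => Lt (ρ 0) (ρ 1) → Lt (ρ 1) c → Lt (ρ 0) c)
    (.imp (.lt (v 1) (v 2)) (.imp (.lt (v 2) (v 0)) (.lt (v 1) (v 0))))
    (by simp) (by simp) ?_
    w (scons a fun _ => b) c
  · exact key h₁ h₂
  · intro w ρ c ih h₁ h₂
    rcases lt_S_iff.1 h₂ with h | h
    · exact lt_S_iff.2 (Or.inl (ih h₁ h))
    · exact lt_S_iff.2 (Or.inl (h ▸ h₁))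

theorem Lt.irrefl (a : M.D w) : ¬ Lt a a := by
  have key := induction_on (M := M) (P := fun w _ a => Lt a a → False)
    (.imp (.lt (v 0) (v 0)) .bot)
    (by simp) (by simp) (by simp) w (fun _ => Z) a
  exact key

theorem exists_lt_lt (a b : M.D w) : ∃ c, Lt a c ∧ Lt b c := by
  refine induction_on (M := M) (P := fun w ρ b => ∃ c, Lt (ρ 0) c ∧ Lt b c)
    (.ex (.and (.lt (v 2) (v 0)) (.lt (v 1) (v 0)))) (by simp) ?_ ?_ w (fun _ => a) b
  · exact fun w ρ => ⟨S (ρ 0), lt_S_self _, Z_lt_S _⟩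
  · rintro w ρ b ⟨c, h₁, h₂⟩
    exact ⟨S c, h₁.trans (lt_S_self c), S_lt_S.2 h₂⟩

theorem eq_of_rsub_eq_Z {a b : M.D w} (h₁ : fn rsubSymb ![b, a] = Z)
    (h₂ : fn rsubSymb ![a, b] = Z) : a = b := by
  have h₁' : Lt a (S b) := by unfold Lt; rwa [fn_rsub_S_S]
  have h₂' : Lt b (S a) := by unfold Lt; rwa [fn_rsub_S_S]
  rcases lt_S_iff.1 h₁' with h | h
  · rcases lt_S_iff.1 h₂' with h' | h'
    · exact absurd (h.trans h') (Lt.irrefl a)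
    · exact h'.symm
  · exact h

theorem fn_rsub_self (a : M.D w) : fn rsubSymb ![a, a] = Z := by
  have := lt_S_self a
  unfold Lt at this; rwa [fn_rsub_S_S] at this

end KModel

-- Characteristic functions and bounded search

/-- Distinction of cases: `cond (0, x, y) = x`, `cond (z + 1, x, y) = y`. -/
def condSymb : PRSymb 3 := .prec (.proj 0) (.proj 3)

/-- The constant function `0`. -/
def zeroSymb (n : ℕ) : PRSymb n := .comp .zero ![]

/-- The constant function `1`. -/
def oneSymb (n : ℕ) : PRSymb n := .comp .succ ![zeroSymb n]

/-- Bounded search: `search f (x, p) = 0` if and only if `f (y, p) = 0` for some `y < x`. -/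
def searchSymb {n : ℕ} (f : PRSymb (n + 1)) : PRSymb (n + 1) :=
  .prec (oneSymb n) (.comp condSymb ![.proj 1, zeroSymb _,
    .comp f (Fin.cons (.proj 0) fun i => .proj i.succ.succ)])

namespace KModel

variable {M : KModel} {w x : M.W}

@[simp] theorem forces_exLT {φ : Fml} {t : Tm} {ρ : ℕ → M.D w} :
    M.Forces (φ.exLT t) w ρ ↔ ∃ a, Lt a (val ρ t) ∧ M.Forces φ w (scons a ρ) := by
  simp [Fml.exLT]

variable [M.IsHA]

@[simp] theorem forces_allLT {φ : Fml} {t : Tm} {ρ : ℕ → M.D w} :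
    M.Forces (φ.allLT t) w ρ ↔ ∀ x (f : M.Hom w x) (a : M.D x),
      Lt a (val (mapEnv f ρ) t) → M.Forces φ x (scons a (mapEnv f ρ)) := by
  simp [Fml.allLT, forces_all]

theorem fn_cond_Z (a b : M.D w) : fn condSymb ![Z, a, b] = a :=
  (fn_prec_zero _ _ ![a, b]).trans (fn_proj _ _)

theorem fn_cond_S (c a b : M.D w) : fn condSymb ![S c, a, b] = b :=
  (fn_prec_succ _ _ c ![a, b]).trans (fn_proj _ _)

@[simp] theorem fn_zeroSymb {n : ℕ} (a : Fin n → M.D w) : fn (zeroSymb n) a = Z := by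
  rw [zeroSymb, fn_comp, comp_vecEmpty fun g => fn g a]; rfl

@[simp] theorem fn_oneSymb {n : ℕ} (a : Fin n → M.D w) : fn (oneSymb n) a = S Z := by
  rw [oneSymb, fn_comp, comp_vecCons fun g => fn g a, comp_vecEmpty fun g => fn g a, fn_zeroSymb]
  rfl

theorem fn_comp₂ {n : ℕ} (f : PRSymb 2) (g h : PRSymb n) (a : Fin n → M.D w) :
    fn (.comp f ![g, h]) a = fn f ![fn g a, fn h a] := by
  rw [fn_comp, comp_vecCons fun g => fn g a, comp_vecCons fun g => fn g a,
    comp_vecEmpty fun g => fn g a]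

theorem fn_comp₃ {n : ℕ} (f : PRSymb 3) (g h k : PRSymb n) (a : Fin n → M.D w) :
    fn (.comp f ![g, h, k]) a = fn f ![fn g a, fn h a, fn k a] := by
  rw [fn_comp, comp_vecCons fun g => fn g a, comp_vecCons fun g => fn g a,
    comp_vecCons fun g => fn g a, comp_vecEmpty fun g => fn g a]

theorem fn_search_Z {n : ℕ} (f : PRSymb (n + 1)) (a : Fin n → M.D w) :
    fn (searchSymb f) (Fin.cons Z a) = S Z :=
  (fn_prec_zero _ _ a).trans (fn_oneSymb a)

theorem fn_search_S {n : ℕ} (f : PRSymb (n + 1)) (b : M.D w) (a : Fin n → M.D w) :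
    fn (searchSymb f) (Fin.cons (S b) a) =
      fn condSymb ![fn (searchSymb f) (Fin.cons b a), Z, fn f (Fin.cons b a)] := by
  refine (fn_prec_succ _ _ b a).trans ?_
  rw [fn_comp₃, fn_proj, fn_zeroSymb, fn_comp, comp_finCons fun g => fn g _]
  simp only [fn_proj]
  rfl

theorem fn_cond_eq_Z {a b : M.D w} : fn condSymb ![a, Z, b] = Z ↔ a = Z ∨ b = Z := by
  rcases eq_Z_or_eq_S a with rfl | ⟨a, rfl⟩
  · simp [fn_cond_Z]
  · simp [fn_cond_S, S_ne_Z]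

theorem fn_search_eq_Z {n : ℕ} (f : PRSymb (n + 1)) (b : M.D w) (a : Fin n → M.D w) :
    fn (searchSymb f) (Fin.cons b a) = Z ↔ ∃ c, Lt c b ∧ fn f (Fin.cons c a) = Z := by
  have key := induction_on (M := M) (P := fun w ρ b => ∀ x (g : M.Hom w x),
      fn (searchSymb f) (Fin.cons (M.map g b) fun i : Fin n => M.map g (ρ i)) = Z ↔
        ∃ c, Lt c (M.map g b) ∧ fn f (Fin.cons c fun i : Fin n => M.map g (ρ i)) = Z)
    (.iff (.eq (app (searchSymb f) (Fin.cons (v 0) fun i => v (i + 1))) zeroT)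
      (.exLT (v 0) (.eq (app f (Fin.cons (v 0) fun i => v (i + 2))) zeroT))) ?_ ?_ ?_
    w (extend a) b w (M.id w)
  · simpa using key
  · intro w ρ b
    simp [forces_iff, comp_finCons]
  · intro w ρ x g
    simp [fn_search_Z, S_ne_Z]
  · intro w ρ b ih x g
    rw [map_S, fn_search_S, fn_cond_eq_Z, ih]
    simp only [lt_S_iff, or_and_right, exists_or, exists_eq_left]

/-- The symbol is sought in every sufficiently large arity so that the subterms can be brought to a
common one. -/
theorem exists_symb_of_term (t : Tm) : ∃ N, ∀ n, N ≤ n → ∃ f : PRSymb n, ∀ (w : M.W)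
    (ρ : ℕ → M.D w), val ρ t = fn f fun i => ρ i := by
  induction t with
  | var i =>
    refine ⟨i + 1, fun n hn => ⟨.proj ⟨i, hn⟩, fun w ρ => ?_⟩⟩
    rw [fn_proj]; rfl
  | func F ts ih =>
    choose N hN using ih
    refine ⟨Finset.univ.sup N, fun n hn => ?_⟩
    choose g hg using fun i => hN i n ((Finset.le_sup (Finset.mem_univ i)).trans hn)
    refine ⟨.comp F g, fun w ρ => ?_⟩
    rw [fn_comp]
    exact congrArg (fn F) (funext fun i => hg i w ρ)

/-- Quantifier-free formulas have primitive recursive characteristic functions. -/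
theorem exists_symb_of_qf {φ : Fml} (hφ : φ.QuantifierFree) : ∃ N, ∀ n, N ≤ n →
    ∃ f : PRSymb n, ∀ (w : M.W) (ρ : ℕ → M.D w), M.Forces φ w ρ ↔ fn f (fun i => ρ i) = Z := by
  induction φ with
  | bot => exact ⟨0, fun n _ => ⟨oneSymb n, fun w ρ => by simp [S_ne_Z]⟩⟩
  | eq s t =>
    obtain ⟨N₁, h₁⟩ := exists_symb_of_term (M := M) s
    obtain ⟨N₂, h₂⟩ := exists_symb_of_term (M := M) t
    refine ⟨max N₁ N₂, fun n hn => ?_⟩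
    obtain ⟨f, hf⟩ := h₁ n (le_trans (le_max_left _ _) hn)
    obtain ⟨g, hg⟩ := h₂ n (le_trans (le_max_right _ _) hn)
    -- The function is `cond (g ∸ f, f ∸ g, 1)`, which vanishes exactly when both truncated
    -- differences do.
    refine ⟨.comp condSymb ![.comp rsubSymb ![f, g], .comp rsubSymb ![g, f], oneSymb n],
      fun w ρ => ?_⟩
    rw [forces_eq, hf, hg, fn_comp₃, fn_comp₂, fn_comp₂, fn_oneSymb]
    constructor
    · intro h
      rw [h, fn_rsub_self, fn_cond_Z]
    · intro h
      rcases eq_Z_or_eq_S (fn rsubSymb ![fn f fun i => ρ i, fn g fun i => ρ i]) with h' | ⟨a, h'⟩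
      · rw [h', fn_cond_Z] at h
        exact (eq_of_rsub_eq_Z h' h).symm
      · rw [h', fn_cond_S] at h
        exact absurd h (S_ne_Z _)
  | and φ ψ ih₁ ih₂ =>
    obtain ⟨N₁, h₁⟩ := ih₁ hφ.1
    obtain ⟨N₂, h₂⟩ := ih₂ hφ.2
    refine ⟨max N₁ N₂, fun n hn => ?_⟩
    obtain ⟨f, hf⟩ := h₁ n (le_trans (le_max_left _ _) hn)
    obtain ⟨g, hg⟩ := h₂ n (le_trans (le_max_right _ _) hn)
    refine ⟨.comp condSymb ![f, g, oneSymb n], fun w ρ => ?_⟩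
    rw [forces_and, hf, hg, fn_comp₃, fn_oneSymb]
    rcases eq_Z_or_eq_S (fn f fun i => ρ i) with h | ⟨a, h⟩ <;>
      simp [h, fn_cond_Z, fn_cond_S, S_ne_Z]
  | or φ ψ ih₁ ih₂ =>
    obtain ⟨N₁, h₁⟩ := ih₁ hφ.1
    obtain ⟨N₂, h₂⟩ := ih₂ hφ.2
    refine ⟨max N₁ N₂, fun n hn => ?_⟩
    obtain ⟨f, hf⟩ := h₁ n (le_trans (le_max_left _ _) hn)
    obtain ⟨g, hg⟩ := h₂ n (le_trans (le_max_right _ _) hn)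
    refine ⟨.comp condSymb ![f, zeroSymb n, g], fun w ρ => ?_⟩
    rw [forces_or, hf, hg, fn_comp₃, fn_zeroSymb, fn_cond_eq_Z]
  | imp φ ψ ih₁ ih₂ =>
    obtain ⟨N₁, h₁⟩ := ih₁ hφ.1
    obtain ⟨N₂, h₂⟩ := ih₂ hφ.2
    refine ⟨max N₁ N₂, fun n hn => ?_⟩
    obtain ⟨f, hf⟩ := h₁ n (le_trans (le_max_left _ _) hn)
    obtain ⟨g, hg⟩ := h₂ n (le_trans (le_max_right _ _) hn)
    refine ⟨.comp condSymb ![f, g, zeroSymb n], fun w ρ => ?_⟩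
    rw [forces_imp_qf hφ.1, hf, hg, fn_comp₃, fn_zeroSymb]
    rcases eq_Z_or_eq_S (fn f fun i => ρ i) with h | ⟨a, h⟩ <;>
      simp [h, fn_cond_Z, fn_cond_S, S_ne_Z]
  | all => exact hφ.elim
  | ex => exact hφ.elim

/-- The bounded search for a zero of the characteristic function of `φ` is itself primitive
recursive, so the quantifier becomes an equation. -/
theorem exists_qf_exLT {φ : Fml} (hφ : φ.QuantifierFree) (t : Tm) : ∃ ψ : Fml,
    ψ.QuantifierFree ∧ ∀ (w : M.W) (ρ : ℕ → M.D w), M.Forces (φ.exLT t) w ρ ↔ M.Forces ψ w ρ := by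
  obtain ⟨N, hN⟩ := exists_symb_of_qf (M := M) hφ
  obtain ⟨f, hf⟩ := hN (N + 1) (Nat.le_succ N)
  refine ⟨.eq (app (searchSymb f) (Fin.cons t fun i => v i)) zeroT, trivial, fun w ρ => ?_⟩
  have hcons : ∀ a : M.D w, (fun i : Fin (N + 1) => scons a ρ i) =
      Fin.cons a fun i : Fin N => ρ i := by
    intro a; funext i
    cases i using Fin.cases <;> rfl
  simp [comp_finCons, fn_search_eq_Z, hf, hcons]

end KModel

-- The arithmetical hierarchy up to equivalence in a model

namespace KModel

/-- The formulas `φ` and `ψ` are forced at the same worlds. -/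
def Equiv (M : KModel) (φ ψ : Fml) : Prop := ∀ w ρ, M.Forces φ w ρ ↔ M.Forces ψ w ρ

/-- The formula `φ` is equivalent to a `Σ_k` formula. -/
def Sig (M : KModel) (k : ℕ) (φ : Fml) : Prop := ∃ ψ ∈ SigmaF k, M.Equiv φ ψ

/-- The formula `φ` is equivalent to a `Π_k` formula. -/
def Pi (M : KModel) (k : ℕ) (φ : Fml) : Prop := ∃ ψ ∈ PiF k, M.Equiv φ ψ

variable {M : KModel} {w x : M.W} {k : ℕ} {φ ψ θ : Fml}

theorem Equiv.rfl' : M.Equiv φ φ := fun _ _ => Iff.rfl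

theorem Equiv.trans (h₁ : M.Equiv φ ψ) (h₂ : M.Equiv ψ θ) : M.Equiv φ θ :=
  fun w ρ => (h₁ w ρ).trans (h₂ w ρ)

theorem Equiv.ex (h : M.Equiv φ ψ) : M.Equiv (.ex φ) (.ex ψ) := fun w ρ => by simp [h w]

theorem Equiv.all (h : M.Equiv φ ψ) : M.Equiv (.all φ) (.all ψ) := fun w ρ => by
  simp [forces_all, h _ _]

theorem Equiv.and {φ' ψ' : Fml} (h₁ : M.Equiv φ φ') (h₂ : M.Equiv ψ ψ') :
    M.Equiv (.and φ ψ) (.and φ' ψ') := fun w ρ => by simp [h₁ w ρ, h₂ w ρ]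

theorem Equiv.imp {φ' ψ' : Fml} (h₁ : M.Equiv φ φ') (h₂ : M.Equiv ψ ψ') :
    M.Equiv (.imp φ ψ) (.imp φ' ψ') := fun w ρ => by simp [forces_imp, h₁ _ _, h₂ _ _]

theorem Equiv.neg (h : M.Equiv φ ψ) : M.Equiv φ.neg ψ.neg := h.imp .rfl'

theorem Equiv.exLT (h : M.Equiv φ ψ) (t : Tm) : M.Equiv (φ.exLT t) (ψ.exLT t) :=
  (Equiv.rfl'.and h).ex

theorem Equiv.allLT (h : M.Equiv φ ψ) (t : Tm) : M.Equiv (φ.allLT t) (ψ.allLT t) :=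
  (Equiv.rfl'.imp h).all

theorem Sig.congr (h : M.Sig k ψ) (e : M.Equiv φ ψ) : M.Sig k φ :=
  let ⟨χ, hχ, e'⟩ := h; ⟨χ, hχ, e.trans e'⟩

theorem Pi.congr (h : M.Pi k ψ) (e : M.Equiv φ ψ) : M.Pi k φ :=
  let ⟨χ, hχ, e'⟩ := h; ⟨χ, hχ, e.trans e'⟩

theorem Sig.subst (h : M.Sig k φ) (σ : ℕ → Tm) : M.Sig k (φ.subst σ) := by
  obtain ⟨ψ, hψ, e⟩ := h
  exact ⟨_, (sigmaF_piF_subst k).1 ψ hψ σ, fun w ρ => by simp [e w]⟩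

theorem Pi.subst (h : M.Pi k φ) (σ : ℕ → Tm) : M.Pi k (φ.subst σ) := by
  obtain ⟨ψ, hψ, e⟩ := h
  exact ⟨_, (sigmaF_piF_subst k).2 ψ hψ σ, fun w ρ => by simp [e w]⟩

theorem Sig.shift (h : M.Sig k φ) : M.Sig k φ.shift := h.subst _

theorem Pi.shift (h : M.Pi k φ) : M.Pi k φ.shift := h.subst _

theorem sig_of_mem (h : φ ∈ SigmaF k) : M.Sig k φ := ⟨φ, h, .rfl'⟩

theorem pi_of_mem (h : φ ∈ PiF k) : M.Pi k φ := ⟨φ, h, .rfl'⟩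

theorem sig_zero_iff : M.Sig 0 φ ↔ ∃ ψ : Fml, ψ.QuantifierFree ∧ M.Equiv φ ψ := by
  simp only [Sig, SigmaF, Set.mem_ofPred_eq]

theorem pi_zero_iff : M.Pi 0 φ ↔ M.Sig 0 φ := by
  simp only [Pi, PiF, Sig, SigmaF, Set.mem_ofPred_eq]

theorem sig_zero (h : φ.QuantifierFree) : M.Sig 0 φ := sig_zero_iff.2 ⟨φ, h, .rfl'⟩

theorem Pi.ex (h : M.Pi k φ) : M.Sig (k + 1) (.ex φ) := by
  obtain ⟨ψ, hψ, e⟩ := h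
  refine ⟨.ex ψ, ?_, e.ex⟩
  simp only [SigmaF, Set.mem_ofPred_eq]
  exact ⟨1, ψ, le_rfl, hψ, rfl⟩

theorem Sig.all (h : M.Sig k φ) : M.Pi (k + 1) (.all φ) := by
  obtain ⟨ψ, hψ, e⟩ := h
  refine ⟨.all ψ, ?_, e.all⟩
  simp only [PiF, Set.mem_ofPred_eq]
  exact ⟨1, ψ, le_rfl, hψ, rfl⟩

theorem Sig.ex (h : M.Sig (k + 1) φ) : M.Sig (k + 1) (.ex φ) := by
  obtain ⟨ψ, hψ, e⟩ := h
  refine ⟨.ex ψ, ?_, e.ex⟩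
  simp only [SigmaF, Set.mem_ofPred_eq] at hψ ⊢
  obtain ⟨n, χ, -, hχ, rfl⟩ := hψ
  exact ⟨n + 1, χ, Nat.le_add_left _ _, hχ, rfl⟩

theorem Pi.all (h : M.Pi (k + 1) φ) : M.Pi (k + 1) (.all φ) := by
  obtain ⟨ψ, hψ, e⟩ := h
  refine ⟨.all ψ, ?_, e.all⟩
  simp only [PiF, Set.mem_ofPred_eq] at hψ ⊢
  obtain ⟨n, χ, -, hχ, rfl⟩ := hψ
  exact ⟨n + 1, χ, Nat.le_add_left _ _, hχ, rfl⟩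

/-- A dummy quantifier is harmless because the domain is inhabited, for example by `ρ 0`. Such
quantifiers supply the levels that the strict prefix classes require. -/
theorem equiv_ex_shift : M.Equiv φ (.ex φ.shift) := fun w ρ => by
  simp only [forces_ex, forces_shift, scons_succ]
  exact ⟨fun h => ⟨ρ 0, h⟩, fun ⟨_, h⟩ => h⟩

theorem equiv_all_shift : M.Equiv φ (.all φ.shift) := fun w ρ => by
  simp only [forces_all, forces_shift, scons_succ]
  exact ⟨fun h x f _ => h.mono f, fun h => by simpa using h w (M.id w) (ρ 0)⟩

theorem Pi.sig_succ (h : M.Pi k φ) : M.Sig (k + 1) φ := h.shift.ex.congr equiv_ex_shift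

theorem Sig.pi_succ (h : M.Sig k φ) : M.Pi (k + 1) φ := h.shift.all.congr equiv_all_shift

/-- Induction on the quantifier prefix of a `Σ_{k+1}` formula. -/
theorem Sig.induction {Q : Fml → Prop} (h : M.Sig (k + 1) φ)
    (congr : ∀ φ ψ, M.Equiv φ ψ → Q ψ → Q φ) (base : ∀ φ, M.Pi k φ → Q φ)
    (step : ∀ φ, Q φ → Q (.ex φ)) : Q φ := by
  obtain ⟨ψ, hψ, e⟩ := h
  refine congr _ _ e ?_
  simp only [SigmaF, Set.mem_ofPred_eq] at hψ
  obtain ⟨n, χ, -, hχ, rfl⟩ := hψ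
  clear e
  induction n with
  | zero => exact base _ (pi_of_mem hχ)
  | succ n ih => exact step _ ih

/-- Induction on the quantifier prefix of a `Π_{k+1}` formula. -/
theorem Pi.induction {Q : Fml → Prop} (h : M.Pi (k + 1) φ)
    (congr : ∀ φ ψ, M.Equiv φ ψ → Q ψ → Q φ) (base : ∀ φ, M.Sig k φ → Q φ)
    (step : ∀ φ, Q φ → Q (.all φ)) : Q φ := by
  obtain ⟨ψ, hψ, e⟩ := h
  refine congr _ _ e ?_
  simp only [PiF, Set.mem_ofPred_eq] at hψ
  obtain ⟨n, χ, -, hχ, rfl⟩ := hψ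
  clear e
  induction n with
  | zero => exact base _ (sig_of_mem hχ)
  | succ n ih => exact step _ ih

theorem sig_pi_succ (k : ℕ) :
    (∀ φ, M.Sig k φ → M.Sig (k + 1) φ) ∧ ∀ φ, M.Pi k φ → M.Pi (k + 1) φ := by
  induction k with
  | zero => exact ⟨fun φ h => (pi_zero_iff.2 h).sig_succ, fun φ h => (pi_zero_iff.1 h).pi_succ⟩
  | succ k ih =>
    constructor
    · intro φ h
      exact h.induction (fun _ _ e h => h.congr e) (fun φ h => (ih.2 φ h).sig_succ) fun _ h => h.ex
    · intro φ h
      exact h.induction (fun _ _ e h => h.congr e) (fun φ h => (ih.1 φ h).pi_succ) fun _ h => h.all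

theorem Sig.mono {l : ℕ} (h : M.Sig k φ) (hkl : k ≤ l) : M.Sig l φ := by
  induction hkl with
  | refl => exact h
  | step _ ih => exact (sig_pi_succ _).1 _ ih

theorem Pi.mono {l : ℕ} (h : M.Pi k φ) (hkl : k ≤ l) : M.Pi l φ := by
  induction hkl with
  | refl => exact h
  | step _ ih => exact (sig_pi_succ _).2 _ ih

theorem sig_of_qf (h : φ.QuantifierFree) : M.Sig k φ := (sig_zero h).mono (Nat.zero_le k)

/-- The leading quantifiers of the two conjuncts are pulled out one after the other, the other
conjunct being shifted; the base case is the dual class one level lower. -/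
theorem sig_pi_and (k : ℕ) : (∀ φ ψ, M.Sig k φ → M.Sig k ψ → M.Sig k (.and φ ψ)) ∧
    ∀ φ ψ, M.Pi k φ → M.Pi k ψ → M.Pi k (.and φ ψ) := by
  induction k with
  | zero =>
    simp only [pi_zero_iff, and_self, sig_zero_iff]
    rintro φ ψ ⟨φ', hφ, e⟩ ⟨ψ', hψ, e'⟩
    exact ⟨.and φ' ψ', ⟨hφ, hψ⟩, e.and e'⟩
  | succ k ih =>
    constructor
    · intro φ ψ hφ
      revert ψ
      refine hφ.induction (Q := fun φ => ∀ ψ, M.Sig (k + 1) ψ → M.Sig (k + 1) (.and φ ψ))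
        (fun _ _ e h ψ hψ => (h ψ hψ).congr (e.and .rfl')) (fun φ hφ ψ hψ => ?_)
        fun φ h ψ hψ => (h _ hψ.shift).ex.congr fun w ρ => by simp
      revert φ
      refine hψ.induction (Q := fun ψ => ∀ φ, M.Pi k φ → M.Sig (k + 1) (.and φ ψ))
        (fun _ _ e h φ hφ => (h φ hφ).congr (Equiv.rfl'.and e))
        (fun ψ hψ φ hφ => (ih.2 _ _ hφ hψ).sig_succ)
        fun ψ h φ hφ => (h _ hφ.shift).ex.congr fun w ρ => by simp
    · intro φ ψ hφ
      revert ψ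
      refine hφ.induction (Q := fun φ => ∀ ψ, M.Pi (k + 1) ψ → M.Pi (k + 1) (.and φ ψ))
        (fun _ _ e h ψ hψ => (h ψ hψ).congr (e.and .rfl')) (fun φ hφ ψ hψ => ?_)
        fun φ h ψ hψ => (h _ hψ.shift).all.congr ?_
      · revert φ
        refine hψ.induction (Q := fun ψ => ∀ φ, M.Sig k φ → M.Pi (k + 1) (.and φ ψ))
          (fun _ _ e h φ hφ => (h φ hφ).congr (Equiv.rfl'.and e))
          (fun ψ hψ φ hφ => (ih.1 _ _ hφ hψ).pi_succ)
          fun ψ h φ hφ => (h _ hφ.shift).all.congr ?_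
        refine fun w ρ => ((equiv_all_shift (φ := φ)).and .rfl' w ρ).trans ?_
        simp only [forces_and, forces_all, forall_and]
      · refine fun w ρ => (Equiv.rfl'.and (equiv_all_shift (φ := ψ)) w ρ).trans ?_
        simp only [forces_and, forces_all, forall_and]

theorem Sig.and (h₁ : M.Sig k φ) (h₂ : M.Sig k ψ) : M.Sig k (.and φ ψ) :=
  (sig_pi_and k).1 _ _ h₁ h₂

theorem Pi.and (h₁ : M.Pi k φ) (h₂ : M.Pi k ψ) : M.Pi k (.and φ ψ) :=
  (sig_pi_and k).2 _ _ h₁ h₂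

variable [M.IsHA]

/-- Pulling `∃` out of the conclusion of an implication is not intuitionistic in general. Here the
premise is decided, and if it fails any element is a witness. -/
theorem sig_pi_qf_imp (k : ℕ) :
    (∀ θ φ, θ.QuantifierFree → M.Sig k φ → M.Sig k (.imp θ φ)) ∧
    ∀ θ φ, θ.QuantifierFree → M.Pi k φ → M.Pi k (.imp θ φ) := by
  induction k with
  | zero =>
    simp only [pi_zero_iff, and_self, sig_zero_iff]
    rintro θ φ hθ ⟨φ', hφ, e⟩
    exact ⟨.imp θ φ', ⟨hθ, hφ⟩, Equiv.rfl'.imp e⟩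
  | succ k ih =>
    constructor
    · intro θ φ hθ hφ
      revert θ
      refine hφ.induction (Q := fun φ => ∀ θ, θ.QuantifierFree → M.Sig (k + 1) (.imp θ φ))
        (fun _ _ e h θ hθ => (h θ hθ).congr (Equiv.rfl'.imp e))
        (fun φ hφ θ hθ => (ih.2 _ _ hθ hφ).sig_succ)
        fun φ h θ hθ => (h _ (hθ.subst fun n => v (n + 1))).ex.congr fun w ρ => ?_
      rw [forces_imp_qf hθ, forces_ex, forces_ex]
      simp only [forces_imp_qf (hθ.subst _), forces_subst, val_v, scons_succ]
      by_cases hc : M.Forces θ w ρ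
      · simp [hc]
      · simpa [hc] using ⟨ρ 0⟩
    · intro θ φ hθ hφ
      revert θ
      refine hφ.induction (Q := fun φ => ∀ θ, θ.QuantifierFree → M.Pi (k + 1) (.imp θ φ))
        (fun _ _ e h θ hθ => (h θ hθ).congr (Equiv.rfl'.imp e))
        (fun φ hφ θ hθ => (ih.1 _ _ hθ hφ).pi_succ)
        fun φ h θ hθ => (h _ (hθ.subst fun n => v (n + 1))).all.congr fun w ρ => ?_
      rw [forces_imp_qf hθ, forces_all, forces_all]
      simp only [forces_imp_qf (hθ.subst _), forces_subst, val_v, scons_succ]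
      refine ⟨fun h x f a h' => h ((forces_mapEnv_iff hθ f).1 h') x f a, fun h h' x f a =>
        h x f a ((forces_mapEnv_iff hθ f).2 h')⟩

theorem Pi.qf_imp (hθ : θ.QuantifierFree) (h : M.Pi k φ) : M.Pi k (.imp θ φ) :=
  (sig_pi_qf_imp k).2 _ _ hθ h

-- Decidable formulas and decidable levels

/-- The formula `φ` is decidable at every world. -/
def Dec (M : KModel) (φ : Fml) : Prop := M.Valid (.or φ φ.neg)

omit [M.IsHA] in
theorem Dec.forces_neg (h : M.Dec φ) {ρ : ℕ → M.D w} : M.Forces φ.neg w ρ ↔ ¬ M.Forces φ w ρ :=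
  ⟨Forces.not_of_neg, (h w ρ).resolve_left⟩

omit [M.IsHA] in
theorem Dec.forces_mapEnv (h : M.Dec φ) (f : M.Hom w x) {ρ : ℕ → M.D w} :
    M.Forces φ x (mapEnv f ρ) ↔ M.Forces φ w ρ := by
  refine ⟨fun h' => ?_, fun h' => h'.mono f⟩
  by_contra hc
  exact h.forces_neg.2 hc x f h'

-- If `φ` can be pulled back along morphisms, then a world that does not force it has no successor
-- that does, so the world forces the negation.
omit [M.IsHA] in
theorem Dec.of_mapEnv (h : ∀ w x (f : M.Hom w x) ρ, M.Forces φ x (mapEnv f ρ) → M.Forces φ w ρ) :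
    M.Dec φ := fun w ρ => by
  by_cases hc : M.Forces φ w ρ
  · exact Or.inl hc
  · exact Or.inr fun x f h' => hc (h _ _ f _ h')

omit [M.IsHA] in
theorem Dec.congr (h : M.Dec ψ) (e : M.Equiv φ ψ) : M.Dec φ := fun w ρ =>
  (h w ρ).imp (e w ρ).2 (e.neg w ρ).2

theorem Sig.dec_of_zero (h : M.Sig 0 φ) : M.Dec φ := by
  obtain ⟨ψ, hψ, e⟩ := sig_zero_iff.1 h
  exact .congr (.of_mapEnv fun w x f ρ => (forces_mapEnv_iff hψ f).1) e

/-- Induction on the bound: each step adds one candidate, and it is decided. -/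
theorem Dec.exLT (h : M.Dec φ) (t : Tm) : M.Dec (φ.exLT t) := by
  let φ' : Fml := φ.subst (up fun n => v (n + 1))
  have key := induction_on (M := M) (P := fun w ρ b => (∃ a, Lt a b ∧ M.Forces φ w (scons a ρ)) ∨
      ∀ x (f : M.Hom w x) a, Lt a (M.map f b) → ¬ M.Forces φ x (scons a (mapEnv f ρ)))
    (.or (φ'.exLT (v 0)) (φ'.exLT (v 0)).neg) ?_ ?_ ?_
  · intro w ρ
    refine (key w ρ (val ρ t)).imp (fun h => by simpa using h) fun h x f h' => ?_
    obtain ⟨a, ha, h'⟩ := forces_exLT.1 h'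
    rw [← map_val] at ha
    exact h x f a ha h'
  · intro w ρ b
    simp [φ', val_up, KModel.forces_neg]; rfl
  · exact fun w ρ => Or.inr fun x f a ha => by simp at ha
  · rintro w ρ b (⟨a, ha, ha'⟩ | hb)
    · exact Or.inl ⟨a, ha.trans (lt_S_self b), ha'⟩
    · rcases h w (scons b ρ) with hd | hd
      · exact Or.inl ⟨b, lt_S_self b, hd⟩
      · refine Or.inr fun x f a ha => ?_
        rw [map_S, lt_S_iff] at ha
        rcases ha with ha | rfl
        · exact hb x f a ha
        · rw [← mapEnv_scons]; exact hd x f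

theorem Dec.allLT_equiv (h : M.Dec φ) (t : Tm) : M.Equiv (φ.allLT t) (φ.neg.exLT t).neg := by
  intro w ρ
  rw [forces_allLT, KModel.forces_neg]
  constructor
  · intro h' x f hx
    obtain ⟨a, ha, hx⟩ := forces_exLT.1 hx
    exact hx.not_of_neg (h' x f a ha)
  · intro h' x f a ha
    by_contra hc
    exact h' x f (forces_exLT.2 ⟨a, ha, h.forces_neg.2 hc⟩)

theorem Dec.exLT_equiv (h : M.Dec φ) (t : Tm) : M.Equiv (φ.exLT t) (φ.neg.allLT t).neg := by
  intro w ρ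
  constructor
  · intro h' x f hx
    obtain ⟨a, ha, h'⟩ := forces_exLT.1 (h'.mono f)
    refine (forces_allLT.1 hx x (M.id x) a (by simpa using ha)).not_of_neg (by simpa using h')
  · intro h'
    by_contra hc
    refine h'.not_of_neg (forces_allLT.2 fun x f a ha y g hy => ?_)
    refine ((h.exLT t).forces_neg.2 hc) y (M.comp f g) (forces_exLT.2 ⟨M.map g a, ?_, ?_⟩)
    · rwa [mapEnv_comp, ← map_val, map_lt]
    · simpa using hy

/-- All `Σ_k` formulas are decidable. -/
def DecLevel (M : KModel) (k : ℕ) : Prop := ∀ φ, M.Sig k φ → M.Dec φ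

theorem decLevel_zero : M.DecLevel 0 := fun _ h => h.dec_of_zero

omit [M.IsHA] in
theorem DecLevel.mono {l : ℕ} (h : M.DecLevel l) (hkl : k ≤ l) : M.DecLevel k :=
  fun φ hφ => h φ (hφ.mono hkl)

-- Intuitionistically `¬ ∃` is `∀ ¬`, so the leading block causes no difficulty; only negating the
-- `Π_k` matrix needs an assumption.
omit [M.IsHA] in
theorem Sig.neg_succ_of (h : M.Sig (k + 1) φ) (hk : ∀ φ, M.Pi k φ → M.Sig k φ.neg) :
    M.Pi (k + 1) φ.neg := by
  refine h.induction (Q := fun φ => M.Pi (k + 1) φ.neg) (fun _ _ e h => h.congr e.neg)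
    (fun φ hφ => (hk φ hφ).pi_succ) fun φ h => h.all.congr fun w ρ => ?_
  simp only [KModel.forces_neg, forces_all, forces_ex]
  constructor
  · rintro h x f a y g ha
    exact h y (M.comp f g) ⟨_, by simpa using ha⟩
  · rintro h x f ⟨a, ha⟩
    exact h x f a x (M.id x) (by simpa using ha)

-- The nontrivial case is `∀ φ` in `Π_{k+1}`. Inductively `∃ ¬ φ` is `Σ_{k+1}`, hence decided; if it
-- fails, decidability of `φ` yields `∀ φ`. So `∀ φ` is decided and its negation is `∃ ¬ φ`.
omit [M.IsHA] in
theorem DecLevel.neg (k : ℕ) : M.DecLevel k → (∀ φ, M.Sig k φ → M.Pi k φ.neg) ∧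
    ∀ φ, M.Pi k φ → M.Sig k φ.neg ∧ M.Dec φ := by
  induction k with
  | zero =>
    refine fun h => ⟨fun φ hφ => ?_, fun φ hφ => ?_⟩
    · obtain ⟨ψ, hψ, e⟩ := sig_zero_iff.1 hφ
      exact pi_zero_iff.2 (sig_zero_iff.2 ⟨ψ.neg, ⟨hψ, trivial⟩, e.neg⟩)
    · obtain ⟨ψ, hψ, e⟩ := sig_zero_iff.1 (pi_zero_iff.1 hφ)
      exact ⟨sig_zero_iff.2 ⟨ψ.neg, ⟨hψ, trivial⟩, e.neg⟩, h _ (pi_zero_iff.1 hφ)⟩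
  | succ k ih =>
    intro h
    obtain ⟨ih₁, ih₂⟩ := ih (h.mono (Nat.le_succ k))
    constructor
    · exact fun φ hφ => hφ.neg_succ_of fun φ hφ => (ih₂ φ hφ).1
    · intro φ hφ
      refine hφ.induction (Q := fun φ => M.Sig (k + 1) φ.neg ∧ M.Dec φ)
        (fun _ _ e h => ⟨h.1.congr e.neg, h.2.congr e⟩)
        (fun φ hφ => ⟨(ih₁ φ hφ).sig_succ, h _ (hφ.mono (Nat.le_succ k))⟩) fun φ hQ => ?_
      have hd := h _ hQ.1.ex
      have hall : ∀ {w} {ρ : ℕ → M.D w}, ¬ M.Forces (.ex φ.neg) w ρ → M.Forces (.all φ) w ρ := by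
        intro w ρ hn x f a
        by_contra hc
        exact hd.forces_neg.2 hn x f ⟨a, hQ.2.forces_neg.2 hc⟩
      have hneg : ∀ {w} {ρ : ℕ → M.D w}, M.Forces (.ex φ.neg) w ρ →
          M.Forces (Fml.all φ).neg w ρ := by
        rintro w ρ h x f h'
        obtain ⟨a, ha⟩ := h.mono f
        exact ha.not_of_neg (h'.all_apply a)
      refine ⟨hQ.1.ex.congr fun w ρ => ⟨fun h' => ?_, hneg⟩, fun w ρ => ?_⟩
      · by_contra hc
        exact h'.not_of_neg (hall hc)
      · by_cases hc : M.Forces (.ex φ.neg) w ρ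
        · exact Or.inr (hneg hc)
        · exact Or.inl (hall hc)

omit [M.IsHA] in
theorem Pi.dec (h : M.Pi k φ) (hk : M.DecLevel k) : M.Dec φ := ((DecLevel.neg k hk).2 φ h).2

omit [M.IsHA] in
theorem Pi.neg (h : M.Pi k φ) (hk : M.DecLevel k) : M.Sig k φ.neg := ((DecLevel.neg k hk).2 φ h).1

omit [M.IsHA] in
theorem Sig.neg (h : M.Sig k φ) (hk : M.DecLevel k) : M.Pi k φ.neg := (DecLevel.neg k hk).1 φ h

omit [M.IsHA] in
/-- Negation turns `Σ_{k+1}` into `Π_{k+1}` if `Σ_k` formulas are decidable. -/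
theorem Sig.neg_succ (h : M.Sig (k + 1) φ) (hk : M.DecLevel k) : M.Pi (k + 1) φ.neg :=
  h.neg_succ_of fun _ hφ => hφ.neg hk

end KModel

-- Bounded quantifiers and normal forms

/-- The renaming that makes room for a new variable with index `2`. -/
def skipTwo : ℕ → Tm := up (up fun n => v (n + 1))

/-- The renaming that makes room for a new variable with index `1`. -/
def skipOne : ℕ → Tm := up fun n => v (n + 1)

namespace KModel

variable {M : KModel} {w x : M.W} {k : ℕ} {φ ψ θ : Fml}

theorem val_skipTwo (a b c : M.D w) (ρ : ℕ → M.D w) :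
    (fun n => val (scons a (scons b (scons c ρ))) (skipTwo n)) = scons a (scons b ρ) := by
  simp [skipTwo, val_up]

theorem val_skipOne (a b : M.D w) (ρ : ℕ → M.D w) :
    (fun n => val (scons a (scons b ρ)) (skipOne n)) = scons a ρ := by
  simp [skipOne, val_up]

variable [M.IsHA]

/-- Collection for arbitrary formulas. -/
theorem forces_allLT_ex (t : Tm) : M.Equiv ((Fml.ex ψ).allLT t)
    (.ex (((ψ.subst skipTwo).exLT (v 1)).allLT (shiftT t))) := by
  intro w ρ
  constructor
  · have key := induction_on (M := M) (P := fun w ρ b => ∀ x (f : M.Hom w x),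
        (∀ y (g : M.Hom x y) a, Lt a (M.map g (M.map f b)) →
          ∃ c, M.Forces ψ y (scons c (scons a (mapEnv g (mapEnv f ρ))))) →
        ∃ s, ∀ y (g : M.Hom x y) a, Lt a (M.map g (M.map f b)) → ∃ c, Lt c (M.map g s) ∧
          M.Forces ψ y (scons c (scons a (mapEnv g (mapEnv f ρ)))))
      (.imp ((Fml.ex (ψ.subst skipTwo)).allLT (v 0))
        (.ex ((((ψ.subst skipTwo).subst skipTwo).exLT (v 1)).allLT (v 1)))) ?_ ?_ ?_
      w ρ (val ρ t) w (M.id w)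
    · intro h
      obtain ⟨s, hs⟩ := key fun y g a ha => by
        simpa using forces_allLT.1 h y g a (by simpa [map_val] using ha)
      refine ⟨s, forces_allLT.2 fun y g a ha => ?_⟩
      obtain ⟨c, hc, h'⟩ := hs y g a (by simpa [map_val] using ha)
      exact forces_exLT.2 ⟨c, hc, by simpa [val_skipTwo] using h'⟩
    · intro w ρ b
      simp [forces_imp, val_skipTwo]
    · exact fun w ρ x f _ => ⟨Z, fun y g a ha => by simp at ha⟩
    · intro w ρ b ih x f h
      obtain ⟨s, hs⟩ := ih x f fun y g a ha => h y g a (by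
        simpa using (lt_S_iff.2 (Or.inl ha)))
      obtain ⟨c, hc⟩ := h x (M.id x) (M.map f b) (by simpa using lt_S_self _)
      obtain ⟨u, hu, hu'⟩ := exists_lt_lt s c
      -- The new bound `u` exceeds the bound for the earlier elements as well as the witness for the
      -- last one.
      refine ⟨u, fun y g a ha => ?_⟩
      rw [map_S, map_S, lt_S_iff] at ha
      rcases ha with ha | rfl
      · obtain ⟨d, hd, h'⟩ := hs y g a ha
        exact ⟨d, hd.trans ((map_lt g).2 hu), h'⟩
      · exact ⟨M.map g c, (map_lt g).2 hu', by simpa using hc.mono g⟩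
  · rintro ⟨s, hs⟩
    refine forces_allLT.2 fun y g a ha => ?_
    obtain ⟨c, -, hc⟩ := forces_exLT.1 (forces_allLT.1 hs y g a (by simpa using ha))
    exact ⟨c, by simpa [val_skipTwo] using hc⟩

/-- Two numbers have a common strict upper bound, so a pair of unbounded quantifiers becomes one
unbounded and two bounded ones. No pairing function is needed. -/
theorem ex_ex_equiv : M.Equiv (.ex (.ex ψ))
    (.ex (((ψ.subst skipTwo).exLT (v 1)).exLT (v 0))) := by
  intro w ρ
  constructor
  · rintro ⟨a, b, h⟩
    obtain ⟨s, hs, hs'⟩ := exists_lt_lt a b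
    exact ⟨s, forces_exLT.2 ⟨a, hs, forces_exLT.2 ⟨b, hs', by simpa [val_skipTwo] using h⟩⟩⟩
  · rintro ⟨s, h⟩
    obtain ⟨a, -, h⟩ := forces_exLT.1 h
    obtain ⟨b, -, h⟩ := forces_exLT.1 h
    exact ⟨a, b, by simpa [val_skipTwo] using h⟩

theorem all_all_equiv : M.Equiv (.all (.all ψ))
    (.all (((ψ.subst skipTwo).allLT (v 1)).allLT (v 0))) := by
  intro w ρ
  constructor
  · intro h x f s
    refine forces_allLT.2 fun y g a _ => forces_allLT.2 fun z i b _ => ?_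
    simpa [val_skipTwo] using h y (M.comp f g) a z i b
  · intro h x f a y g b
    obtain ⟨s, hs, hs'⟩ := exists_lt_lt (M.map g a) b
    have h₁ := forces_allLT.1 (h y (M.comp f g) s) y (M.id y) (M.map g a) (by simpa using hs)
    simpa [val_skipTwo] using forces_allLT.1 h₁ y (M.id y) b (by simpa using hs')

/-- `Σ_k` and `Π_k` are closed under bounded quantification. -/
structure BoundedClosed (M : KModel) (k : ℕ) : Prop where
  sig_exLT : ∀ φ t, M.Sig k φ → M.Sig k (Fml.exLT t φ)
  sig_allLT : ∀ φ t, M.Sig k φ → M.Sig k (Fml.allLT t φ)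
  pi_exLT : ∀ φ t, M.Pi k φ → M.Pi k (Fml.exLT t φ)
  pi_allLT : ∀ φ t, M.Pi k φ → M.Pi k (Fml.allLT t φ)

/-- Repeated merging of two adjacent quantifiers; the bounded quantifiers that arise are absorbed by
the `Π_k` matrix. -/
theorem BoundedClosed.sig_normal (hb : M.BoundedClosed k) (h : M.Sig (k + 1) φ) :
    ∃ ψ, M.Pi k ψ ∧ M.Equiv φ (.ex ψ) := by
  refine h.induction (Q := fun φ => ∃ ψ, M.Pi k ψ ∧ M.Equiv φ (.ex ψ)) ?_
    (fun φ hφ => ⟨_, hφ.shift, equiv_ex_shift⟩) ?_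
  · rintro φ φ' e ⟨ψ, hψ, e'⟩
    exact ⟨ψ, hψ, e.trans e'⟩
  · rintro φ ⟨ψ, hψ, e⟩
    exact ⟨_, hb.pi_exLT _ _ (hb.pi_exLT _ _ (hψ.subst _)), e.ex.trans ex_ex_equiv⟩

theorem BoundedClosed.pi_normal (hb : M.BoundedClosed k) (h : M.Pi (k + 1) φ) :
    ∃ ψ, M.Sig k ψ ∧ M.Equiv φ (.all ψ) := by
  refine h.induction (Q := fun φ => ∃ ψ, M.Sig k ψ ∧ M.Equiv φ (.all ψ)) ?_
    (fun φ hφ => ⟨_, hφ.shift, equiv_all_shift⟩) ?_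
  · rintro φ φ' e ⟨ψ, hψ, e'⟩
    exact ⟨ψ, hψ, e.trans e'⟩
  · rintro φ ⟨ψ, hψ, e⟩
    exact ⟨_, hb.sig_allLT _ _ (hb.sig_allLT _ _ (hψ.subst _)), e.all.trans all_all_equiv⟩

/-- At level `0` bounded search does it. At level `k + 1`, `∀ y < t` is moved past the `∃` of a
normal form by collection, and `∃ y < t` in front of a `Π_{k+1}` formula reduces to this through `¬
∀ y < t ¬`, using that level `k + 1` is decidable. -/
theorem DecLevel.boundedClosed : ∀ {k}, M.DecLevel k → M.BoundedClosed k := by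
  intro k
  induction k with
  | zero =>
    intro hk
    have hex : ∀ φ t, M.Sig 0 φ → M.Sig 0 (Fml.exLT t φ) := by
      intro φ t hφ
      obtain ⟨ψ, hψ, e⟩ := sig_zero_iff.1 hφ
      obtain ⟨χ, hχ, e'⟩ := exists_qf_exLT (M := M) hψ t
      exact (sig_zero hχ).congr ((e.exLT t).trans e')
    have hneg : ∀ φ, M.Sig 0 φ → M.Sig 0 φ.neg := fun φ h => pi_zero_iff.1 (h.neg hk)
    have hall : ∀ φ t, M.Sig 0 φ → M.Sig 0 (Fml.allLT t φ) := fun φ t h =>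
      (hneg _ (hex _ _ (hneg _ h))).congr ((hk φ h).allLT_equiv t)
    refine ⟨hex, hall, ?_, ?_⟩ <;> simpa only [pi_zero_iff]
  | succ k ih =>
    intro hk
    have hb := ih (hk.mono (Nat.le_succ k))
    have hall : ∀ φ t, M.Sig (k + 1) φ → M.Sig (k + 1) (Fml.allLT t φ) := by
      intro φ t h
      obtain ⟨ψ, hψ, e⟩ := hb.sig_normal h
      exact (hb.pi_allLT _ _ (hb.pi_exLT _ _ (hψ.subst _))).ex.congr
        ((e.allLT t).trans (forces_allLT_ex t))
    refine ⟨fun φ t h => ?_, hall, fun φ t h => ?_, fun φ t h => ?_⟩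
    · exact ((sig_of_qf (φ := .lt _ _) trivial).and h).ex
    · exact ((hall _ _ (h.neg hk)).neg hk).congr ((h.dec hk).exLT_equiv t)
    · exact (h.qf_imp (θ := .lt _ _) trivial).all

end KModel

-- De Morgan's law and contrapositive collection

/-- The renaming that exchanges the first two variables. -/
def swap : ℕ → Tm := scons (v 1) (scons (v 0) fun n => v (n + 2))

/-- The renaming that exchanges the first two variables and makes room for a new variable with
index `2`. -/
def swapSkip : ℕ → Tm := scons (v 1) (scons (v 0) fun n => v (n + 3))

namespace KModel

variable {M : KModel} {w x : M.W} {k : ℕ} {φ ψ θ χ : Fml}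

theorem val_swap (a b : M.D w) (ρ : ℕ → M.D w) :
    (fun n => val (scons a (scons b ρ)) (swap n)) = scons b (scons a ρ) := by
  funext n
  rcases n with _ | _ | n <;> rfl

theorem val_swapSkip (a b c : M.D w) (ρ : ℕ → M.D w) :
    (fun n => val (scons a (scons b (scons c ρ))) (swapSkip n)) = scons b (scons a ρ) := by
  funext n
  rcases n with _ | _ | n <;> rfl

/-- De Morgan's law is forced for formulas equivalent to `Σ_k` formulas. -/
def DMLLevel (M : KModel) (k : ℕ) : Prop := ∀ φ ψ, M.Sig k φ → M.Sig k ψ → ∀ w ρ,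
  M.Forces (Fml.and φ ψ).neg w ρ → M.Forces φ.neg w ρ ∨ M.Forces ψ.neg w ρ

theorem dmlLevel_of_validSet (h : M.ValidSet (DML (SigmaF k))) : M.DMLLevel k := by
  rintro φ ψ ⟨φ', hφ, e⟩ ⟨ψ', hψ, e'⟩ w ρ h'
  have := h _ ⟨φ', hφ, ψ', hψ, rfl⟩ w ρ
  exact ((this.imp_apply (((e.and e').neg w ρ).1 h'))).imp (e.neg w ρ).2 (e'.neg w ρ).2

theorem validSet_DML (h : M.DMLLevel k) : M.ValidSet (DML (SigmaF k)) := by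
  rintro _ ⟨φ, hφ, ψ, hψ, rfl⟩ w ρ x f h'
  exact h φ ψ (sig_of_mem hφ) (sig_of_mem hψ) x _ h'

theorem decLevel_of_validSet (h : M.ValidSet (LEM (SigmaF k))) : M.DecLevel k := by
  rintro φ ⟨ψ, hψ, e⟩
  exact .congr (h _ ⟨ψ, hψ, rfl⟩) e

theorem validSet_LEM (h : M.DecLevel k) : M.ValidSet (LEM (SigmaF k)) := by
  rintro _ ⟨φ, hφ, rfl⟩
  exact h φ (sig_of_mem hφ)

theorem validSet_DNE (h : M.DecLevel k) : M.ValidSet (DNE (SigmaF k)) := by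
  rintro _ ⟨φ, hφ, rfl⟩ w ρ x f h'
  exact (h φ (sig_of_mem hφ) x (mapEnv f ρ)).resolve_right fun hn => h'.not_of_neg hn

variable [M.IsHA]

/-- De Morgan's law and double negation elimination make `Σ_k` formulas decidable. -/
theorem decLevel_of_dml_dne (hd : M.DMLLevel (k + 1)) (hn : M.ValidSet (DNE (SigmaF k))) :
    M.DecLevel k := by
  suffices ∀ j ≤ k, M.DecLevel j from this k le_rfl
  intro j
  induction j with
  | zero => exact fun _ => decLevel_zero
  | succ j ih =>
    intro hj φ hφ w ρ
    -- By decidability one level lower, `¬ φ` is `Π_{j+1}`, hence `Σ_{k+1}` because `j + 1 ≤ k`; so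
    -- De Morgan's law applies to `φ` and `¬ φ`.
    have hneg := hφ.neg_succ (ih (Nat.le_of_succ_le hj))
    rcases hd φ φ.neg (hφ.mono (hj.trans (Nat.le_succ k))) (hneg.sig_succ.mono (by omega)) w ρ
      (fun x f h => h.2.not_of_neg h.1) with h | h
    · exact Or.inr h
    · obtain ⟨ψ, hψ, e⟩ := hφ.mono hj
      refine Or.inl ((e w ρ).2 ?_)
      exact (hn _ ⟨ψ, hψ, rfl⟩ w ρ).imp_apply ((e.neg.neg w ρ).1 h)

/-- Collection for a decidable matrix that is antitone in the bound. -/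
theorem exists_forces_all_of_forall (hk : M.DecLevel k) (hd : M.DMLLevel (k + 1))
    (hθ : M.Sig k θ)
    (anti : ∀ w (ρ : ℕ → M.D w) y a b, Lt a b → M.Forces θ w (scons b (scons y ρ)) →
      M.Forces θ w (scons a (scons y ρ)))
    (ρ : ℕ → M.D w) (b : M.D w)
    (h : ∀ x (f : M.Hom w x) c, ∃ y, Lt y (M.map f b) ∧
      M.Forces θ x (scons c (scons y (mapEnv f ρ)))) :
    ∃ y, Lt y b ∧ M.Forces (.all θ) w (scons y ρ) := by
  have hb := hk.boundedClosed
  -- `C(c, b)` is `∃ y < b θ(c, y)`, again a decidable `Σ_k` formula.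
  let C : Fml := (θ.subst swapSkip).exLT (v 1)
  have hC : M.Sig k C := hb.sig_exLT _ _ (hθ.subst _)
  have hCf : ∀ {w : M.W} (c b : M.D w) (ρ : ℕ → M.D w), M.Forces C w (scons c (scons b ρ)) ↔
      ∃ y, Lt y b ∧ M.Forces θ w (scons c (scons y ρ)) := by
    intro w c b ρ
    simp [C, val_swapSkip]
  have key := induction_on (M := M) (P := fun w ρ b => ∀ x (f : M.Hom w x),
      (∀ y (g : M.Hom x y) c, M.Forces C y (scons c (mapEnv g (scons (M.map f b) (mapEnv f ρ))))) →
      ∃ y, Lt y (M.map f b) ∧ M.Forces (.all θ) x (scons y (mapEnv f ρ)))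
    (.imp (.all C) (.exLT (v 0) (.all (θ.subst skipTwo)))) ?_ ?_ ?_
  · have := key w ρ b w (M.id w) fun x f c => by
      rw [mapEnv_scons, hCf]
      simpa using h x f c
    simpa using this
  · intro w ρ b
    simp [forces_imp, forces_all, val_skipTwo]
  · intro w ρ x f h
    have := h x (M.id x) Z
    rw [mapEnv_scons, hCf] at this
    simp at this
  · intro w ρ b ih x f h
    have h' : ∀ y (g : M.Hom x y) c, ∃ u, Lt u (S (M.map g (M.map f b))) ∧
        M.Forces θ y (scons c (scons u (mapEnv g (mapEnv f ρ)))) := by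
      intro y g c
      have := h y g c
      rw [mapEnv_scons, hCf] at this
      simpa using this
    -- Take `e` above both alleged counterexamples. A `y ≤ b` with `θ(e, y)` refutes the first if `y
    -- < b` and the second if `y = b`, by antitonicity.
    have hneg : M.Forces (Fml.and (.ex C.neg) (.ex θ.neg)).neg x
        (scons (M.map f b) (mapEnv f ρ)) := by
      rintro y g ⟨⟨c, hc⟩, ⟨d, hd'⟩⟩
      rw [mapEnv_scons] at hc hd'
      obtain ⟨e, hce, hde⟩ := exists_lt_lt c d
      obtain ⟨u, hu, hu'⟩ := h' y g e
      rcases lt_S_iff.1 hu with hu | rfl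
      · exact hc.not_of_neg ((hCf _ _ _).2 ⟨u, hu, anti _ _ _ _ _ hce hu'⟩)
      · exact hd'.not_of_neg (anti _ _ _ _ _ hde hu')
    rcases hd _ _ (hC.neg hk).ex (hθ.neg hk).ex x _ hneg with hl | hr
    · obtain ⟨y, hy, hy'⟩ := ih x f fun y g c => by
        by_contra hc
        exact hl y g ⟨c, (hk _ hC).forces_neg.2 hc⟩
      refine ⟨y, ?_, hy'⟩
      rw [map_S]
      exact hy.trans (lt_S_self _)
    · refine ⟨M.map f b, by simpa using lt_S_self _, fun y g c => ?_⟩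
      by_contra hc
      exact hr y g ⟨c, (hk _ hθ).forces_neg.2 (by simpa using hc)⟩

/-- The collection principle for formulas equivalent to `Π_k` formulas. -/
def COLLLevel (M : KModel) (k : ℕ) : Prop := ∀ φ, M.Pi k φ → ∀ w (ρ : ℕ → M.D w) b,
  (∀ x (f : M.Hom w x) c, ∃ y, Lt y (M.map f b) ∧ ∀ z (g : M.Hom x z) a, Lt a (M.map g c) →
    M.Forces φ z (scons a (scons (M.map g y) (mapEnv g (mapEnv f ρ))))) →
  ∃ y, Lt y b ∧ M.Forces (.all φ) w (scons y ρ)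

theorem forces_collInstance {i : ℕ} {ρ : ℕ → M.D w} : M.Forces (collInstance i φ) w ρ ↔
    ∀ u (e : M.Hom w u),
      (∀ x (f : M.Hom u x) c, ∃ y, Lt y (M.map f (M.map e (ρ i))) ∧ ∀ z (g : M.Hom x z) a,
        Lt a (M.map g c) →
          M.Forces φ z (scons a (scons (M.map g y) (mapEnv g (mapEnv f (mapEnv e ρ)))))) →
      ∃ y, Lt y (M.map e (ρ i)) ∧ M.Forces (.all φ) u (scons y (mapEnv e ρ)) := by
  simp only [collInstance, forces_imp, forces_all, forces_exLT, forces_allLT, forces_subst, val_up,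
    val_v, scons_zero, scons_succ, mapEnv_scons, mapEnv_apply]
  rfl

theorem validSet_COLL (h : M.COLLLevel k) : M.ValidSet (COLL (PiF k)) := by
  rintro _ ⟨φ, hφ, i, rfl⟩ w ρ
  exact forces_collInstance.2 fun u e => h φ (pi_of_mem hφ) u _ _

/-- The bound in an instance must be a variable. The element `b` is therefore inserted as a new
outside variable `0`, and `skipTwo` renames `φ` to avoid it. -/
theorem collLevel_of_validSet (h : M.ValidSet (COLL (PiF k))) : M.COLLLevel k := by
  rintro φ ⟨φ', hφ, e⟩ w ρ b h'
  have := forces_collInstance.1 (h _ ⟨_, (sigmaF_piF_subst k).2 _ hφ skipTwo, 0, rfl⟩ w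
    (scons b ρ)) w (M.id w)
  simp only [mapEnv_id, mapEnv_scons, forces_subst, val_skipTwo, scons_zero, KModel.map_id,
    forces_all] at this
  obtain ⟨y, hy, hy'⟩ := this fun x f c => by
    obtain ⟨y, hy, h'⟩ := h' x f c
    exact ⟨y, hy, fun z g a ha => (e _ _).1 (h' z g a ha)⟩
  exact ⟨y, hy, fun x f a => (e _ _).2 (by simpa using hy' x f a)⟩

/-- With `φ(y, a)` in the normal form `∀ d ψ`, the matrix `∀ a < c ∀ d < c ψ` is `Σ_k` and antitone
in `c`, and it holds for all `c` exactly when `∀ a φ(y, a)` does. -/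
theorem COLLLevel.of_dml (hk : M.DecLevel k) (hd : M.DMLLevel (k + 1)) : M.COLLLevel (k + 1) := by
  intro φ hφ w ρ b h
  have hb := hk.boundedClosed
  obtain ⟨ψ, hψ, e⟩ := hb.pi_normal hφ
  let θ : Fml := ((ψ.subst skipTwo).allLT (v 1)).allLT (v 0)
  have hθf : ∀ {w : M.W} (c y : M.D w) (ρ : ℕ → M.D w), M.Forces θ w (scons c (scons y ρ)) ↔
      ∀ x (f : M.Hom w x) a, Lt a (M.map f c) → ∀ z (g : M.Hom x z) d,
        Lt d (M.map g (M.map f c)) → M.Forces ψ z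
          (scons d (scons (M.map g a) (scons (M.map g (M.map f y)) (mapEnv g (mapEnv f ρ))))) := by
    intro w c y ρ
    simp [θ, val_skipTwo]
  have hθ : M.Sig k θ := hb.sig_allLT _ _ (hb.sig_allLT _ _ (hψ.subst _))
  have anti : ∀ w (ρ : ℕ → M.D w) y a b, Lt a b → M.Forces θ w (scons b (scons y ρ)) →
      M.Forces θ w (scons a (scons y ρ)) := by
    intro w ρ y a b hab h
    rw [hθf] at h ⊢
    intro x f c hc z g d hd
    exact h x f c (hc.trans ((map_lt f).2 hab)) z g d
      (hd.trans ((map_lt g).2 ((map_lt f).2 hab)))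
  obtain ⟨y, hy, hy'⟩ := exists_forces_all_of_forall hk hd hθ anti ρ b fun x f c => by
    obtain ⟨y, hy, hy'⟩ := h x f c
    refine ⟨y, hy, (hθf _ _ _).2 fun z g a ha u i d _ => ?_⟩
    simpa using (e _ _).1 (hy' z g a ha) u i d
  refine ⟨y, hy, fun x f a => (e _ _).2 fun z g d => ?_⟩
  obtain ⟨u, hu, hu'⟩ := exists_lt_lt (M.map g a) d
  have := hy' z (M.comp f g) u
  simp only [mapEnv_comp, mapEnv_scons] at this
  simpa using (hθf _ _ _).1 this z (M.id z) _ (by simpa using hu) z (M.id z) d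
    (by simpa using hu')

/-- A bounded existential quantifier in front of a `Π_{k+1}` formula can be absorbed. -/
theorem pi_exLT (hk : M.DecLevel k) (hd : M.DMLLevel (k + 1)) (hφ : M.Pi (k + 1) φ) (i : ℕ) :
    M.Pi (k + 1) (φ.exLT (v i)) := by
  have hb := hk.boundedClosed
  obtain ⟨ψ, hψ, e⟩ := hb.pi_normal hφ
  let θ : Fml := (ψ.subst skipOne).allLT (v 0)
  have hθf : ∀ {w : M.W} (c y : M.D w) (ρ : ℕ → M.D w), M.Forces θ w (scons c (scons y ρ)) ↔
      ∀ x (f : M.Hom w x) a, Lt a (M.map f c) →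
        M.Forces ψ x (scons a (scons (M.map f y) (mapEnv f ρ))) := by
    intro w c y ρ
    simp [θ, val_skipOne]
  have hθ : M.Sig k θ := hb.sig_allLT _ _ (hψ.subst _)
  -- The new `Π_{k+1}` formula is `∀ c ∃ y < x θ(c, y)`; `swap` is needed since `c` is now bound
  -- outside `y`.
  refine (hb.sig_exLT _ (v (i + 1)) (hθ.subst swap)).all.congr fun w ρ => ?_
  rw [forces_exLT, forces_all]
  simp only [forces_exLT, forces_subst, val_swap, val_v, scons_succ, mapEnv_apply]
  constructor
  · rintro ⟨y, hy, h⟩ x f c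
    refine ⟨M.map f y, (map_lt f).2 hy, (hθf _ _ _).2 fun z g a _ => ?_⟩
    simpa using (e _ _).1 h z (M.comp f g) a
  · intro h
    obtain ⟨y, hy, hy'⟩ := exists_forces_all_of_forall hk hd hθ (fun w ρ y a b hab h => by
      rw [hθf] at h ⊢
      exact fun x f c hc => h x f c (hc.trans ((map_lt f).2 hab))) ρ (ρ i) h
    refine ⟨y, hy, (e _ _).2 fun x f a => ?_⟩
    have := hy' x f (S a)
    -- The bound `S a` is the least one that covers `d = a`.
    rw [mapEnv_scons, hθf] at this
    simpa using this x (M.id x) a (by simpa using lt_S_self a)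

/-- Collection decides between two `Π_{k+1}` formulas one of which holds below each bound. -/
theorem COLLLevel.all_or_all (hc : M.COLLLevel (k + 1)) (hφ : M.Pi (k + 1) φ)
    (hψ : M.Pi (k + 1) ψ) (ρ : ℕ → M.D w)
    (h : ∀ x (f : M.Hom w x) c,
      (∀ z (g : M.Hom x z) a, Lt a (M.map g c) →
        M.Forces φ z (scons a (mapEnv g (mapEnv f ρ)))) ∨
      ∀ z (g : M.Hom x z) a, Lt a (M.map g c) →
        M.Forces ψ z (scons a (mapEnv g (mapEnv f ρ)))) :
    M.Forces (.all φ) w ρ ∨ M.Forces (.all ψ) w ρ := by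
  -- The variable `y` selects the disjunct: `φ` for `y = 0` and `ψ` otherwise. The guards are
  -- quantifier-free, so `χ` stays `Π_{k+1}`, and collection below `2` fixes one choice for all
  -- bounds.
  let χ : Fml := .and (.imp (.eq (v 1) zeroT) (φ.subst skipOne))
    (.imp (Fml.eq (v 1) zeroT).neg (ψ.subst skipOne))
  have hχ : M.Pi (k + 1) χ :=
    ((hφ.subst _).qf_imp (θ := .eq _ _) trivial).and
      ((hψ.subst _).qf_imp (θ := .neg (.eq _ _)) ⟨trivial, trivial⟩)
  have hχf : ∀ {w : M.W} (a y : M.D w) (ρ : ℕ → M.D w), M.Forces χ w (scons a (scons y ρ)) ↔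
      (y = Z → M.Forces φ w (scons a ρ)) ∧ (y ≠ Z → M.Forces ψ w (scons a ρ)) := by
    intro w a y ρ
    have hneg : M.Forces (Fml.eq (v 1) zeroT).neg w (scons a (scons y ρ)) ↔ y ≠ Z := by
      refine (forces_imp_qf (φ := .eq (v 1) zeroT) trivial).trans ?_
      simp
    simp only [χ, forces_and]
    rw [forces_imp_qf (φ := .eq (v 1) zeroT) trivial,
      forces_imp_qf (φ := .neg (.eq (v 1) zeroT)) ⟨trivial, trivial⟩, hneg]
    simp [val_skipOne]
  obtain ⟨y, hy, hy'⟩ := hc χ hχ w ρ (S (S Z)) fun x f c => by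
    rcases h x f c with h | h
    · refine ⟨Z, by simp, fun z g a ha => (hχf _ _ _).2 ⟨fun _ => h z g a ha, fun hn => ?_⟩⟩
      exact absurd (map_Z g) hn
    · refine ⟨S Z, by simp, fun z g a ha => (hχf _ _ _).2 ⟨fun hn => ?_, fun _ => h z g a ha⟩⟩
      exact absurd hn (by simpa using S_ne_Z _)
  rcases eq_Z_or_eq_S y with rfl | ⟨y, rfl⟩
  · refine Or.inl fun x f a => ?_
    have := hy' x f a
    rw [mapEnv_scons, hχf] at this
    exact this.1 (map_Z f)
  · refine Or.inr fun x f a => ?_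
    have := hy' x f a
    rw [mapEnv_scons, hχf] at this
    exact this.2 (by simpa using S_ne_Z _)

/-- The formula `∀ t < z ¬ ψ(t)`, with `z` the variable `0`. -/
def noneBelow (ψ : Fml) : Fml := (ψ.subst skipOne).neg.allLT (v 0)

theorem forces_noneBelow {c : M.D w} {ρ : ℕ → M.D w} : M.Forces (noneBelow ψ) w (scons c ρ) ↔
    ∀ x (f : M.Hom w x) a, Lt a (M.map f c) → M.Forces ψ.neg x (scons a (mapEnv f ρ)) := by
  simp [noneBelow, KModel.forces_neg, val_skipOne]

theorem forces_neg_ex_of_noneBelow {ρ : ℕ → M.D w} (h : M.Forces (.all (noneBelow ψ)) w ρ) :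
    M.Forces (Fml.ex ψ).neg w ρ := by
  rintro x f ⟨a, ha⟩
  have := forces_noneBelow.1 (h x f (S a)) x (M.id x) a (by simpa using lt_S_self a)
  exact this.not_of_neg (by simpa using ha)

theorem pi_noneBelow (hk : M.DecLevel k) (hψ : M.Pi k ψ) : M.Pi (k + 1) (noneBelow ψ) :=
  (hk.boundedClosed.sig_allLT _ _ ((hψ.subst _).neg hk)).pi_succ

/-- Bounded search for a witness of a decidable formula. -/
theorem Dec.exists_or_noneBelow (h : M.Dec ψ) (c : M.D w) (ρ : ℕ → M.D w) :
    (∃ a, M.Forces ψ w (scons a ρ)) ∨ ∀ z (g : M.Hom w z) a, Lt a (M.map g c) →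
      M.Forces (noneBelow ψ) z (scons a (mapEnv g ρ)) := by
  have hd : M.Dec (ψ.subst skipOne) := .of_mapEnv fun w x f ρ hx => by
    simp only [forces_subst] at hx ⊢
    have he : (fun n => val (mapEnv f ρ) (skipOne n)) = mapEnv f fun n => val ρ (skipOne n) :=
      funext fun n => (map_val f ρ _).symm
    rwa [he, h.forces_mapEnv] at hx
  rcases hd.exLT (v 0) w (scons c ρ) with h' | h'
  · obtain ⟨a, -, ha⟩ := forces_exLT.1 h'
    exact Or.inl ⟨a, by simpa [val_skipOne] using ha⟩
  · refine Or.inr fun z g a ha => forces_noneBelow.2 fun x f d hda y i hy => ?_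
    refine h' y (M.comp g (M.comp f i)) (forces_exLT.2 ⟨M.map i d, ?_, ?_⟩)
    · simpa using hda.trans ((map_lt f).2 ha)
    · simpa [val_skipOne] using hy

/-- For `φ = ∃ a ψ` with `ψ` decidable, search below each bound finds a witness or shows that there
is none there. Collection turns this into the choice between `φ` and `¬ φ`. -/
theorem COLLLevel.decLevel (hc : M.COLLLevel (k + 1)) : M.DecLevel k := by
  suffices ∀ j ≤ k, M.DecLevel j from this k le_rfl
  intro j
  induction j with
  | zero => exact fun _ => decLevel_zero
  | succ j ih =>
    intro hj φ hφ w ρ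
    have hk := ih (Nat.le_of_succ_le hj)
    obtain ⟨ψ, hψ, e⟩ := hk.boundedClosed.sig_normal hφ
    -- Both alternatives must be `Π_{k+1}`. The `Σ_{j+1}` formula `φ`, with a dummy variable, is
    -- `Π_{j+2}`, which is allowed because `j + 1 ≤ k`.
    have := hc.all_or_all ((pi_noneBelow hk hψ).mono (by omega))
      (hφ.pi_succ.shift.mono (by omega)) ρ fun x f c => by
        rcases (hψ.dec hk).exists_or_noneBelow c (mapEnv f ρ) with h | h
        · refine Or.inr fun z g a _ => ?_
          exact forces_shift.2 (((e _ _).2 h).mono g)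
        · exact Or.inl h
    exact this.symm.imp (equiv_all_shift w ρ).2
      fun h => (e.neg w ρ).2 (forces_neg_ex_of_noneBelow h)

/-- If the search below `c` finds a witness for `φ`, then `¬ (φ ∧ ψ)` excludes every witness for
`ψ`; otherwise `φ` has none below `c`. Collection makes the choice uniform in `c`. -/
theorem COLLLevel.dmlLevel (hc : M.COLLLevel (k + 1)) : M.DMLLevel (k + 1) := by
  intro φ ψ hφ hψ w ρ h
  have hk := hc.decLevel
  obtain ⟨φ', hφ', e⟩ := hk.boundedClosed.sig_normal hφ
  obtain ⟨ψ', hψ', e'⟩ := hk.boundedClosed.sig_normal hψ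
  have := hc.all_or_all (pi_noneBelow hk hφ') (pi_noneBelow hk hψ') ρ fun x f c => by
    rcases (hφ'.dec hk).exists_or_noneBelow c (mapEnv f ρ) with h₁ | h₁
    · refine Or.inr fun z g a _ => forces_noneBelow.2 fun y i d _ u j hu => ?_
      refine h u (M.comp f (M.comp g (M.comp i j))) ⟨?_, (e' _ _).2 ⟨_, by simpa using hu⟩⟩
      simpa using (((e _ _).2 h₁).mono (M.comp g (M.comp i j)))
    · exact Or.inl h₁
  exact this.imp (fun h => (e.neg w ρ).2 (forces_neg_ex_of_noneBelow h))
    fun h => (e'.neg w ρ).2 (forces_neg_ex_of_noneBelow h)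

end KModel

-- From models back to provability

theorem equivOver_of_forall {P Q : Set Fml}
    (h : ∀ (M : KModel) [M.IsHA], M.ValidSet P ↔ M.ValidSet Q) : EquivOver HA P Q :=
  ⟨fun φ hφ => provable_of_valid ((h _).1 (canonicalModel_validSet P) φ hφ),
    fun φ hφ => provable_of_valid ((h _).2 (canonicalModel_validSet Q) φ hφ)⟩

theorem KModel.validSet_union {M : KModel} {P Q : Set Fml} :
    M.ValidSet (P ∪ Q) ↔ M.ValidSet P ∧ M.ValidSet Q := by
  simp only [ValidSet, Set.mem_union, or_imp, forall_and]

namespace KModel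

variable {M : KModel} [M.IsHA] {k : ℕ}

omit [M.IsHA] in
theorem validSet_DML_LEM : M.ValidSet (DML (SigmaF (k + 1)) ∪ LEM (SigmaF k)) ↔
    M.DMLLevel (k + 1) ∧ M.DecLevel k := by
  rw [validSet_union]
  exact ⟨fun h => ⟨dmlLevel_of_validSet h.1, decLevel_of_validSet h.2⟩,
    fun h => ⟨validSet_DML h.1, validSet_LEM h.2⟩⟩

theorem validSet_DML_DNE : M.ValidSet (DML (SigmaF (k + 1)) ∪ DNE (SigmaF k)) ↔
    M.DMLLevel (k + 1) ∧ M.DecLevel k := by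
  rw [validSet_union]
  refine ⟨fun h => ?_, fun h => ⟨validSet_DML h.1, validSet_DNE h.2⟩⟩
  have := dmlLevel_of_validSet h.1
  exact ⟨this, decLevel_of_dml_dne this h.2⟩

theorem validSet_COLL_iff : M.ValidSet (COLL (PiF (k + 1))) ↔
    M.DMLLevel (k + 1) ∧ M.DecLevel k := by
  refine ⟨fun h => ?_, fun h => validSet_COLL (.of_dml h.2 h.1)⟩
  have := collLevel_of_validSet h
  exact ⟨this.dmlLevel, this.decLevel⟩

end KModel

end HeytingArith

theorem mainTheorem2 (k : ℕ) :
    (HeytingArith.EquivOver HeytingArith.HA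
        (HeytingArith.COLL (HeytingArith.PiF (k + 1)))
        (HeytingArith.DML (HeytingArith.SigmaF (k + 1)) ∪
          HeytingArith.LEM (HeytingArith.SigmaF k)) ∧
      HeytingArith.EquivOver HeytingArith.HA
        (HeytingArith.COLL (HeytingArith.PiF (k + 1)))
        (HeytingArith.DML (HeytingArith.SigmaF (k + 1)) ∪
          HeytingArith.DNE (HeytingArith.SigmaF k)) ∧
      HeytingArith.EquivOver HeytingArith.HA
        (HeytingArith.DML (HeytingArith.SigmaF (k + 1)) ∪
          HeytingArith.LEM (HeytingArith.SigmaF k))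
        (HeytingArith.DML (HeytingArith.SigmaF (k + 1)) ∪
          HeytingArith.DNE (HeytingArith.SigmaF k))) ∧
    (∀ φ ∈ HeytingArith.PiF (k + 1), ∀ x : ℕ, ∃ ψ ∈ HeytingArith.PiF (k + 1),
      HeytingArith.Provable
        (HeytingArith.addPrinciple HeytingArith.HA
          (HeytingArith.DML (HeytingArith.SigmaF (k + 1)) ∪
            HeytingArith.DNE (HeytingArith.SigmaF k)))
        (HeytingArith.Fml.iff (HeytingArith.Fml.exLT (HeytingArith.v x) φ) ψ)) := by
  refine ⟨⟨?_, ?_, ?_⟩, fun φ hφ x => ?_⟩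
  · exact HeytingArith.equivOver_of_forall fun M _ =>
      HeytingArith.KModel.validSet_COLL_iff.trans HeytingArith.KModel.validSet_DML_LEM.symm
  · exact HeytingArith.equivOver_of_forall fun M _ =>
      HeytingArith.KModel.validSet_COLL_iff.trans HeytingArith.KModel.validSet_DML_DNE.symm
  · exact HeytingArith.equivOver_of_forall fun M _ =>
      HeytingArith.KModel.validSet_DML_LEM.trans HeytingArith.KModel.validSet_DML_DNE.symm
  -- The formula `ψ` is constructed in the canonical model of this very theory, where forced
  -- equivalence everywhere amounts to provable equivalence.
  · obtain ⟨hd, hk⟩ :=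
      HeytingArith.KModel.validSet_DML_DNE.1 (HeytingArith.canonicalModel_validSet _)
    obtain ⟨ψ, hψ, e⟩ :=
      HeytingArith.KModel.pi_exLT hk hd (HeytingArith.KModel.pi_of_mem hφ) x
    exact ⟨ψ, hψ, HeytingArith.provable_of_valid fun w ρ =>
      HeytingArith.KModel.forces_iff.2 fun _ _ => e _ _⟩
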